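/- Let $R$ be a commutative noetherian local ring with maximal ideal $\mathfrak m$ and residue field $k=R/\mathfrak m$, and let $\widehat R$ be its $\mathfrak m$-adic completion. An $R$-module $M$ is *mini-max* if it has a noetherian submodule $N$ such that $M/N$ is artinian. For a commutative local ring $S$ with residue field $\kappa$, let $E_S$ be the injective hull of $\kappa$ over $S$; an $S$-module $L$ is *Matlis reflexive over $S$* if the natural biduality map $L\to\operatorname{Hom}_S(\operatorname{Hom}_S(L,E_S),E_S)$, $x\mapsto(\psi\mapsto\psi(x))$, is an isomorphism. Theorem. Let $M$ and $M'$ be mini-max $R$-modules, let $i\ge 0$, and set $\mathfrak a=\operatorname{Ann}_R(M)+\operatorname{Ann}_R(M')$. (a) If the ring $R/\mathfrak a$ is complete (that is, separated and complete in its $\mathfrak m(R/\mathfrak a)$-adic topology), then $\operatorname{Ext}^i_R(M,M')$ is Matlis reflexive over $R$ and over $\widehat R$. Here $\operatorname{Ext}^i_R(M,M')$, which is annihilated by $\mathfrak a$, is an $\widehat R$-module through the canonical ring homomorphism $\widehat R\to R/\mathfrak a$. (b) If the ring $R/\mathfrak a$ is artinian, then $\operatorname{Ext}^i_R(M,M')$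 has finite length over $R$. -/

import Mathlib

universe u

/-! ### Injective hulls -/

/-- An `R`-linear map `f : M → E` is an injective hull of `M` when `E` is an injective module and
`f` is an essential monomorphism: `f` is injective and every nonzero submodule of `E` meets the
image of `f` nontrivially. -/
structure IsInjectiveHull {R : Type u} [CommRing R] {M E : Type u} [AddCommGroup M] [Module R M]
    [AddCommGroup E] [Module R E] (f : M →ₗ[R] E) : Prop where
  injective_module : Module.Injective R E
  injective : Function.Injective f
  essential : ∀ K : Submodule R E, K ⊓ LinearMap.range f = ⊥ → K = ⊥

/-- Every module embeds into an injective module. -/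
theorem exists_injective_embedding (R : Type u) [CommRing R] (M : Type u) [AddCommGroup M]
    [Module R M] : ∃ (I : ModuleCat.{u} R) (f : M →ₗ[R] I),
      Module.Injective R I ∧ Function.Injective f := by
  let P := (CategoryTheory.EnoughInjectives.presentation (ModuleCat.of R M)).some
  refine ⟨P.J, P.f.hom, ?_, ?_⟩
  · have := P.injective
    exact Module.injective_module_of_injective_object R P.J
  · have := P.mono
    exact (ModuleCat.mono_iff_injective P.f).1 this

/-- A submodule `F` of an injective module `I` that is maximal among the essential extensions of
a submodule `K` inside `I` is injective. -/
theorem injective_of_maximal_essential {R : Type u} [CommRing R] {I : Type u} [AddCommGroup I]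
    [Module R I] (hI : Module.Injective R I) (K F : Submodule R I)
    (hF : Maximal (fun N : Submodule R I => K ≤ N ∧ ∀ L ≤ N, L ⊓ K = ⊥ → L = ⊥) F) :
    Module.Injective R F := by
  obtain ⟨⟨hKF, hess⟩, hmax⟩ := hF
  -- a submodule `C` maximal with `C ⊓ F = ⊥`
  obtain ⟨C, hC⟩ : ∃ C : Submodule R I, Maximal (fun C => Disjoint C F) C := by
    obtain ⟨C, -, hC⟩ := zorn_le_nonempty₀ {C : Submodule R I | Disjoint C F}
      (fun c hc hchain y hy => ⟨sSup c, by
        exact ((hchain.directedOn).disjoint_sSup_right.2 fun b hb =>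
          (show Disjoint b F from hc hb).symm).symm,
        fun z hz => le_sSup hz⟩) ⊥ disjoint_bot_left
    exact ⟨C, hC⟩
  have hdisj : Disjoint C F := hC.prop
  have hj : Function.Injective (C.mkQ ∘ₗ F.subtype) := by
    rw [← LinearMap.ker_eq_bot, LinearMap.ker_eq_bot']
    intro x hx
    have : (x : I) ∈ C := by simpa using hx
    exact Subtype.ext (Submodule.disjoint_def.1 hdisj _ this x.2)
  obtain ⟨h, hh⟩ := hI.out (C.mkQ ∘ₗ F.subtype) hj F.subtype
  -- `r` is an endomorphism of `I` that kills `C` and is the identity on `F`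
  set r : I →ₗ[R] I := h ∘ₗ C.mkQ with hr
  have hrF : ∀ x ∈ F, r x = x := fun x hx => hh ⟨x, hx⟩
  have hrC : ∀ x ∈ C, r x = 0 := fun x hx => by
    have : C.mkQ x = 0 := by simpa using hx
    rw [hr, LinearMap.comp_apply, this, map_zero]
  have hker : LinearMap.ker r = C := by
    refine le_antisymm (hC.le_of_ge ?_ fun x hx => hrC x hx) fun x hx => hrC x hx
    rw [Submodule.disjoint_def]
    intro x hx hxF
    rw [← hrF x hxF]
    exact hx
  have hFr : F ≤ LinearMap.range r := fun x hx => ⟨x, hrF x hx⟩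
  have hrange : LinearMap.range r ≤ F := by
    refine hmax ⟨hKF.trans hFr, fun L hL hLK => ?_⟩ hFr
    -- it suffices that `L` is disjoint from `F`
    have hLF : L ⊓ F = ⊥ := hess _ inf_le_right (by
      rw [inf_assoc, inf_eq_right.2 hKF, hLK])
    have hle : C ≤ L.comap r := fun x hx => by simp [hrC x hx]
    have hdis : Disjoint (L.comap r) F := by
      rw [Submodule.disjoint_def]
      intro x hx hxF
      have hxL : x ∈ L := by simpa [hrF x hxF] using hx
      have : x ∈ L ⊓ F := ⟨hxL, hxF⟩
      simpa [hLF] using this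
    have hcomap : L.comap r ≤ C := hC.le_of_ge hdis hle
    rw [eq_bot_iff]
    intro y hy
    obtain ⟨x, rfl⟩ := hL hy
    exact hrC x (hcomap hy)
  constructor
  intro X Y _ _ _ _ f hf g
  obtain ⟨g', hg'⟩ := hI.out f hf (F.subtype ∘ₗ g)
  refine ⟨(r ∘ₗ g').codRestrict F fun y => hrange ⟨_, rfl⟩, fun x => Subtype.ext ?_⟩
  change r (g' (f x)) = g x
  rw [hg']
  exact hrF _ (g x).2

/-- Every module has an injective hull. -/
theorem exists_isInjectiveHull (R : Type u) [CommRing R] (M : Type u) [AddCommGroup M]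
    [Module R M] : ∃ (E : ModuleCat.{u} R) (f : M →ₗ[R] E), IsInjectiveHull f := by
  obtain ⟨I, f, hI, hf⟩ := exists_injective_embedding R M
  obtain ⟨F, hKF, hF⟩ := zorn_le_nonempty₀
    {N : Submodule R I | LinearMap.range f ≤ N ∧ ∀ L ≤ N, L ⊓ LinearMap.range f = ⊥ → L = ⊥}
    (fun c hc hchain y hy => by
      refine ⟨sSup c, ⟨(hc hy).1.trans (le_sSup hy), fun L hL hLK => ?_⟩, fun z hz => le_sSup hz⟩
      rw [eq_bot_iff]
      intro x hx
      obtain ⟨N, hN, hxN⟩ := (Submodule.mem_sSup_of_directed ⟨y, hy⟩ hchain.directedOn).1 (hL hx)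
      have := (hc hN).2 (L ⊓ N) inf_le_right (by
        rw [eq_bot_iff, ← hLK]
        exact inf_le_inf_right _ inf_le_left)
      rw [← this]
      exact ⟨hx, hxN⟩)
    (LinearMap.range f) ⟨le_rfl, fun L hL hLK => by rwa [inf_eq_left.2 hL] at hLK⟩
  refine ⟨ModuleCat.of R F, f.codRestrict F fun x => hKF ⟨x, rfl⟩,
    injective_of_maximal_essential hI _ F hF, fun x y hxy => hf (congrArg Subtype.val hxy),
    fun K hK => ?_⟩
  have key : K.map F.subtype = ⊥ := hF.prop.2 _ (Submodule.map_subtype_le F K) (by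
    rw [eq_bot_iff]
    rintro x ⟨⟨k, hk, rfl⟩, ⟨m, hm⟩⟩
    have hkm : k ∈ K ⊓ LinearMap.range (f.codRestrict F fun x => hKF ⟨x, rfl⟩) :=
      ⟨hk, m, Subtype.ext hm⟩
    have : k = 0 := by
      have h2 := hK ▸ hkm
      simpa using h2
    simp [this])
  exact (Submodule.map_injective_of_injective F.injective_subtype) (by rw [key, Submodule.map_bot])

/-! ### Matlis duality over a local ring -/

/-- `E_R(k)`: the injective hull of the residue field `k` of the local ring `R`. -/
noncomputable def residueInjectiveHull (R : Type u) [CommRing R] [IsLocalRing R] :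
    ModuleCat.{u} R :=
  (exists_isInjectiveHull R (IsLocalRing.ResidueField R)).choose

/-- The embedding of the residue field into its injective hull. -/
noncomputable def residueInjectiveHullMap (R : Type u) [CommRing R] [IsLocalRing R] :
    IsLocalRing.ResidueField R →ₗ[R] residueInjectiveHull R :=
  (exists_isInjectiveHull R (IsLocalRing.ResidueField R)).choose_spec.choose

theorem isInjectiveHull_residueInjectiveHullMap (R : Type u) [CommRing R] [IsLocalRing R] :
    IsInjectiveHull (residueInjectiveHullMap R) :=
  (exists_isInjectiveHull R (IsLocalRing.ResidueField R)).choose_spec.choose_spec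

/-- The Matlis dual `Hom_R(L, E_R(k))`. -/
abbrev MatlisDual (R : Type u) [CommRing R] [IsLocalRing R] (L : Type u) [AddCommGroup L]
    [Module R L] : Type u :=
  L →ₗ[R] residueInjectiveHull R

/-- The natural biduality map from `L` to its double Matlis dual, `x ↦ (ψ ↦ ψ x)`. -/
noncomputable def matlisBiduality (R : Type u) [CommRing R] [IsLocalRing R] (L : Type u)
    [AddCommGroup L] [Module R L] : L →ₗ[R] MatlisDual R (MatlisDual R L) where
  toFun x :=
    { toFun := fun ψ => ψ x
      map_add' := fun _ _ => rfl
      map_smul' := fun _ _ => rfl }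
  map_add' x y := LinearMap.ext fun ψ => map_add ψ x y
  map_smul' r x := LinearMap.ext fun ψ => map_smul ψ r x

/-- `L` is Matlis reflexive over the local ring `R` when the biduality map is an isomorphism. -/
def IsMatlisReflexive (R : Type u) [CommRing R] [IsLocalRing R] (L : Type u) [AddCommGroup L]
    [Module R L] : Prop :=
  Function.Bijective (matlisBiduality R L)

/-- `M` is mini-max when it has a noetherian submodule `N` such that `M / N` is artinian. -/
def IsMiniMax (R : Type u) [CommRing R] (M : Type u) [AddCommGroup M] [Module R M] : Prop :=
  ∃ N : Submodule R M, IsNoetherian R N ∧ IsArtinian R (M ⧸ N)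

/-! ### The completion and its action on modules killed by `𝔞` with `R / 𝔞` complete -/

/-- The `𝔪`-adic completion of the local ring `R`. -/
abbrev LocalCompletion (R : Type u) [CommRing R] [IsLocalRing R] : Type u :=
  AdicCompletion (IsLocalRing.maximalIdeal R) R

/-- The quotient ring `R / 𝔞` of the local ring `R` is complete, i.e. Hausdorff and complete in
the adic topology of `𝔪 (R / 𝔞)`. -/
abbrev IsCompleteQuotient (R : Type u) [CommRing R] [IsLocalRing R] (a : Ideal R) : Prop :=
  IsAdicComplete ((IsLocalRing.maximalIdeal R).map (Ideal.Quotient.mk a)) (R ⧸ a)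

/-- The ring homomorphism `R̂ → R / 𝔪 ^ n → (R / 𝔞) / 𝔪 ^ n (R / 𝔞)`. -/
noncomputable def completionToQuotientPow (R : Type u) [CommRing R] [IsLocalRing R] (a : Ideal R)
    (n : ℕ) : LocalCompletion R →+*
      (R ⧸ a) ⧸ ((IsLocalRing.maximalIdeal R).map (Ideal.Quotient.mk a)) ^ n :=
  (Ideal.quotientMap _ (Ideal.Quotient.mk a)
    (Ideal.map_le_iff_le_comap.1 (Ideal.map_pow (Ideal.Quotient.mk a) _ n).le)).comp
    (AdicCompletion.evalₐ (IsLocalRing.maximalIdeal R) n : LocalCompletion R →+*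
      R ⧸ (IsLocalRing.maximalIdeal R) ^ n)

theorem completionToQuotientPow_compat (R : Type u) [CommRing R] [IsLocalRing R] (a : Ideal R)
    {m n : ℕ} (hle : m ≤ n) :
    (Ideal.Quotient.factorPow ((IsLocalRing.maximalIdeal R).map (Ideal.Quotient.mk a)) hle).comp
      (completionToQuotientPow R a n) = completionToQuotientPow R a m := by
  ext x
  obtain ⟨y, rfl⟩ := AdicCompletion.mk_surjective _ _ x
  simp only [completionToQuotientPow, RingHom.comp_apply, RingHom.coe_coe,
    AdicCompletion.evalₐ_mk, Ideal.quotientMap_mk]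
  change Ideal.Quotient.mk _ (Ideal.Quotient.mk a (y.1 n)) = _
  rw [← sub_eq_zero, ← map_sub, ← map_sub,
    Ideal.Quotient.eq_zero_iff_mem, ← Ideal.map_pow]
  refine Ideal.mem_map_of_mem _ ?_
  have := (AdicCompletion.AdicCauchySequence.mk_eq_mk hle y)
  rw [Submodule.Quotient.eq] at this
  simpa using this

/-- The canonical ring homomorphism `R̂ → R / 𝔞` for `R / 𝔞` complete: the limit of the maps
`R̂ → (R / 𝔞) / 𝔪 ^ n (R / 𝔞)`. -/
noncomputable def completionToQuotient {R : Type u} [CommRing R] [IsLocalRing R] {a : Ideal R}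
    (hc : IsCompleteQuotient R a) : LocalCompletion R →+* R ⧸ a :=
  haveI : IsAdicComplete ((IsLocalRing.maximalIdeal R).map (Ideal.Quotient.mk a)) (R ⧸ a) := hc
  IsAdicComplete.liftRingHom ((IsLocalRing.maximalIdeal R).map (Ideal.Quotient.mk a))
    (completionToQuotientPow R a) (completionToQuotientPow_compat R a)

theorem completionToQuotient_algebraMap {R : Type u} [CommRing R] [IsLocalRing R] {a : Ideal R}
    (hc : IsCompleteQuotient R a) (r : R) :
    completionToQuotient hc (algebraMap R (LocalCompletion R) r) = Ideal.Quotient.mk a r := by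
  have : IsAdicComplete ((IsLocalRing.maximalIdeal R).map (Ideal.Quotient.mk a)) (R ⧸ a) := hc
  have key : ((completionToQuotient hc).comp (algebraMap R (LocalCompletion R))) =
      Ideal.Quotient.mk a := by
    apply DFunLike.coe_injective
    apply IsHausdorff.funext' ((IsLocalRing.maximalIdeal R).map (Ideal.Quotient.mk a))
    intro n x
    change Ideal.Quotient.mk _ (completionToQuotient hc (algebraMap R _ x)) = _
    rw [completionToQuotient, IsAdicComplete.mk_liftRingHom]
    simp [completionToQuotientPow]
  exact congrArg (fun g => g r) key

/-- If `R / 𝔞` is complete, then an `R`-module `L` with `𝔞 L = 0` is an `R̂`-module through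
`R̂ → R / 𝔞`: if `s : R̂` and `r : R` have the same image in `R / 𝔞`, then `s • x = r • x`. -/
@[reducible]
noncomputable def completionModule {R : Type u} [CommRing R] [IsLocalRing R] {a : Ideal R}
    (hc : IsCompleteQuotient R a) (L : Type u) [AddCommGroup L] [Module R L]
    (ha : a ≤ Module.annihilator R L) : Module (LocalCompletion R) L :=
  letI : Module (R ⧸ a) L := Module.IsTorsionBySet.module (R := R) (M := L) (I := a)
    fun x r => Module.mem_annihilator.1 (ha r.2) x
  Module.compHom L (completionToQuotient hc)

theorem completionModule_smul {R : Type u} [CommRing R] [IsLocalRing R] {a : Ideal R}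
    (hc : IsCompleteQuotient R a) (L : Type u) [AddCommGroup L] [Module R L]
    (ha : a ≤ Module.annihilator R L) (s : LocalCompletion R) (r : R)
    (hsr : completionToQuotient hc s = Ideal.Quotient.mk a r) (x : L) :
    letI := completionModule hc L ha
    s • x = r • x := by
  let : Module (R ⧸ a) L := Module.IsTorsionBySet.module (R := R) (M := L) (I := a)
    fun x r => Module.mem_annihilator.1 (ha r.2) x
  change completionToQuotient hc s • x = r • x
  rw [hsr]
  rfl

/-- The `R̂`-module structure extends the given `R`-module structure. -/
theorem completionModule_isScalarTower {R : Type u} [CommRing R] [IsLocalRing R] {a : Ideal R}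
    (hc : IsCompleteQuotient R a) (L : Type u) [AddCommGroup L] [Module R L]
    (ha : a ≤ Module.annihilator R L) :
    letI := completionModule hc L ha
    IsScalarTower R (LocalCompletion R) L := by
  let := completionModule hc L ha
  refine IsScalarTower.of_algebraMap_smul fun r x => ?_
  exact completionModule_smul hc L ha _ r (completionToQuotient_algebraMap hc r) x

/-! ### Ext modules -/

/-- The `R`-module `Ext^i_R(M, M')`. -/
abbrev ExtModule (R : Type u) [CommRing R] (M M' : Type u) [AddCommGroup M] [Module R M]
    [AddCommGroup M'] [Module R M'] (i : ℕ) : Type u :=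
  CategoryTheory.Abelian.Ext (ModuleCat.of R M) (ModuleCat.of R M') i

/-- `Ann M + Ann M'` annihilates `Ext^i_R(M, M')`. -/
theorem annihilator_sup_le_annihilator_ext (R : Type u) [CommRing R] (M M' : Type u)
    [AddCommGroup M] [Module R M] [AddCommGroup M'] [Module R M'] (i : ℕ) :
    Module.annihilator R M ⊔ Module.annihilator R M' ≤
      Module.annihilator R (ExtModule R M M' i) := by
  refine sup_le (fun r hr => ?_) (fun r hr => ?_) <;> rw [Module.mem_annihilator] <;> intro x
  · have h0 : r • CategoryTheory.CategoryStruct.id (ModuleCat.of R M) = 0 := by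
      ext y
      exact Module.mem_annihilator.1 hr y
    calc r • x = r • (CategoryTheory.Abelian.Ext.mk₀
            (CategoryTheory.CategoryStruct.id (ModuleCat.of R M))).comp x (zero_add i) := by
          rw [CategoryTheory.Abelian.Ext.mk₀_id_comp]
      _ = 0 := by
          rw [← CategoryTheory.Abelian.Ext.smul_comp, ← CategoryTheory.Abelian.Ext.mk₀_smul, h0,
            CategoryTheory.Abelian.Ext.mk₀_zero, CategoryTheory.Abelian.Ext.zero_comp]
  · have h0 : r • CategoryTheory.CategoryStruct.id (ModuleCat.of R M') = 0 := by
      ext y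
      exact Module.mem_annihilator.1 hr y
    rw [CategoryTheory.Abelian.Ext.smul_eq_comp_mk₀, h0, CategoryTheory.Abelian.Ext.mk₀_zero,
      CategoryTheory.Abelian.Ext.comp_zero]

/-! Write `E` for the injective hull of the residue field `k`, `L^∨` for `Hom(L, E)` and `𝔞` for
`Ann M + Ann M'`. The long exact sequences of Ext reduce the theorem to `M` and `M'` each noetherian
or artinian, because submodules and quotients have larger annihilators, and both reflexivity and
finite length pass to the middle of an exact sequence (`ext_of_isMiniMax`). If `M` is noetherian,
Ext is noetherian or artinian along with `M'`. If `M` is artinian, Ext is the Matlis dual of an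
artinian module (`exists_ext_equiv_dual`). All these modules are killed by `𝔞`. If `R / 𝔞` is
complete, it is reflexive, hence so are the noetherian and the artinian modules killed by `𝔞` and
their duals; if `R / 𝔞` is artinian, all of them have finite length.

The artinian case is handled over `R` itself. Endomorphisms of `E` act compatibly on every artinian
module, and a submodule of `A^∨` stable under them is the annihilator of its annihilator in `A`.
Hence stable subquotients of `A^∨` are again duals of artinian modules. When all `Ext^j(k, X)` are
artinian, this covers `Hom(A, X)` and `Ext^1(A, X)`, and dimension shifting gives the rest.

Reflexivity moves from `R` to its completion through `R / 𝔞`, a quotient of both: over a quotient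
ring the injective hull is the part of `E` killed by the kernel
(`isMatlisReflexive_iff_of_surjective`). -/

/-! ### Maps into the injective hull of the residue field -/

section Cogenerator

variable {R : Type u} [CommRing R]

/-- A linear map into an injective module factors through every linear map with smaller kernel. -/
theorem Module.Injective.exists_comp_eq_of_ker_le {E : Type u} [AddCommGroup E] [Module R E]
    (hE : Module.Injective R E) {X Y : Type u} [AddCommGroup X] [Module R X] [AddCommGroup Y]
    [Module R Y] (F : X →ₗ[R] Y) (g : X →ₗ[R] E) (h : LinearMap.ker F ≤ LinearMap.ker g) :
    ∃ g' : Y →ₗ[R] E, g' ∘ₗ F = g := by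
  obtain ⟨g', hg'⟩ := hE.out ((LinearMap.ker F).liftQ F le_rfl)
    (LinearMap.ker_eq_bot.1 (Submodule.ker_liftQ_eq_bot _ _ _ le_rfl))
    ((LinearMap.ker F).liftQ g h)
  exact ⟨g', LinearMap.ext fun x => by simpa using hg' (Submodule.Quotient.mk x)⟩

variable [IsLocalRing R]

theorem injective_residueInjectiveHull : Module.Injective R (residueInjectiveHull R) :=
  (isInjectiveHull_residueInjectiveHullMap R).injective_module

theorem exists_comp_eq_of_ker_le {X Y : Type u} [AddCommGroup X] [Module R X] [AddCommGroup Y]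
    [Module R Y] (F : X →ₗ[R] Y) (g : X →ₗ[R] residueInjectiveHull R)
    (h : LinearMap.ker F ≤ LinearMap.ker g) :
    ∃ g' : Y →ₗ[R] residueInjectiveHull R, g' ∘ₗ F = g :=
  injective_residueInjectiveHull.exists_comp_eq_of_ker_le F g h

variable {L : Type u} [AddCommGroup L] [Module R L]

/-- `E` is a cogenerator: the annihilator of `x ≠ 0` lies in the maximal ideal, the kernel of `R → k
→ E`, so this map factors through `1 ↦ x`. -/
theorem exists_apply_ne_zero {x : L} (hx : x ≠ 0) :
    ∃ f : L →ₗ[R] residueInjectiveHull R, f x ≠ 0 := by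
  let p : R →ₗ[R] residueInjectiveHull R :=
    residueInjectiveHullMap R ∘ₗ Algebra.linearMap R (IsLocalRing.ResidueField R)
  have hp : ∀ r, p r = 0 ↔ r ∈ IsLocalRing.maximalIdeal R := fun r => by
    rw [← IsLocalRing.residue_eq_zero_iff]
    exact map_eq_zero_iff (residueInjectiveHullMap R)
      (isInjectiveHull_residueInjectiveHullMap R).injective
  obtain ⟨f, hf⟩ := exists_comp_eq_of_ker_le (LinearMap.toSpanSingleton R L x) p fun r hr => by
    rw [LinearMap.mem_ker, hp, IsLocalRing.mem_maximalIdeal, mem_nonunits_iff]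
    intro hu
    exact hx ((IsUnit.smul_eq_zero hu).1 (by simpa using hr))
  refine ⟨f, fun h0 => ?_⟩
  have h1 : p 1 = 0 := by rw [← hf]; simpa using h0
  rw [hp] at h1
  exact (Ideal.ne_top_iff_one _).1 (IsLocalRing.maximalIdeal.isMaximal R).ne_top h1

theorem exists_apply_ne_zero_of_notMem {N : Submodule R L} {x : L} (hx : x ∉ N) :
    ∃ f : L →ₗ[R] residueInjectiveHull R, N ≤ LinearMap.ker f ∧ f x ≠ 0 := by
  obtain ⟨f, hf⟩ := exists_apply_ne_zero (R := R) (x := N.mkQ x) (by simpa using hx)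
  exact ⟨f ∘ₗ N.mkQ, fun y hy => by simp [(Submodule.Quotient.mk_eq_zero N).2 hy], hf⟩

theorem eq_zero_of_forall_apply_eq_zero {x : L}
    (h : ∀ f : L →ₗ[R] residueInjectiveHull R, f x = 0) : x = 0 := by
  by_contra hx
  obtain ⟨f, hf⟩ := exists_apply_ne_zero (R := R) hx
  exact hf (h f)

theorem annihilator_dual_le :
    Module.annihilator R (MatlisDual R L) ≤ Module.annihilator R L := fun r hr => by
  rw [Module.mem_annihilator] at hr ⊢
  exact fun x => eq_zero_of_forall_apply_eq_zero fun f => by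
    rw [map_smul]
    exact LinearMap.congr_fun (hr f) x

/-! ### Matlis reflexive modules -/

/-- Biduality is always injective because `E` is a cogenerator, so only surjectivity matters. -/
theorem isMatlisReflexive_iff : IsMatlisReflexive R L ↔
    ∀ Ψ : MatlisDual R L →ₗ[R] residueInjectiveHull R, ∃ x : L, ∀ f : MatlisDual R L, Ψ f = f x := by
  constructor
  · intro h Ψ
    obtain ⟨x, rfl⟩ := h.2 Ψ
    exact ⟨x, fun f => rfl⟩
  · refine fun h => ⟨?_, fun Ψ => ?_⟩
    · rw [← LinearMap.ker_eq_bot, LinearMap.ker_eq_bot']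
      exact fun x hx => eq_zero_of_forall_apply_eq_zero fun f => LinearMap.congr_fun hx f
    · obtain ⟨x, hx⟩ := h Ψ
      exact ⟨x, LinearMap.ext fun f => (hx f).symm⟩

theorem IsMatlisReflexive.of_subsingleton [Subsingleton L] : IsMatlisReflexive R L :=
  isMatlisReflexive_iff.2 fun Ψ => ⟨0, fun f => by
    rw [Subsingleton.elim f 0, map_zero, LinearMap.zero_apply]⟩

variable {A B C : Type u} [AddCommGroup A] [Module R A] [AddCommGroup B] [Module R B]
  [AddCommGroup C] [Module R C]

/-- Restricted to functionals factoring through `g`, `Ψ` is evaluation at some `c`, and `c = g b`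
since functionals detect the range of `g`. Then `Ψ - ev_b` kills those functionals, so it factors
through restriction to `A` and is evaluation at some `f a`. Exactness at `B` alone suffices, so
submodules and quotients are special cases. -/
theorem IsMatlisReflexive.of_exact {f : A →ₗ[R] B} {g : B →ₗ[R] C} (hfg : Function.Exact f g)
    (hA : IsMatlisReflexive R A) (hC : IsMatlisReflexive R C) : IsMatlisReflexive R B := by
  rw [isMatlisReflexive_iff] at hA hC ⊢
  intro Ψ
  obtain ⟨c, hc⟩ := hC (Ψ ∘ₗ LinearMap.lcomp R _ g)
  obtain ⟨b, rfl⟩ : c ∈ LinearMap.range g := by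
    by_contra hcg
    obtain ⟨h, hh, hne⟩ := exists_apply_ne_zero_of_notMem hcg
    refine hne ?_
    rw [← hc h]
    have : LinearMap.lcomp R (residueInjectiveHull R) g h = 0 :=
      LinearMap.ext fun x => hh ⟨x, rfl⟩
    rw [LinearMap.comp_apply, this, map_zero]
  have key : LinearMap.ker (LinearMap.lcomp R (residueInjectiveHull R) f) ≤
      LinearMap.ker (Ψ - matlisBiduality R B b) := by
    intro h hh
    obtain ⟨h', rfl⟩ := exists_comp_eq_of_ker_le g h (by
      intro x hx
      obtain ⟨a, rfl⟩ := (hfg x).1 hx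
      exact LinearMap.congr_fun hh a)
    rw [LinearMap.mem_ker, LinearMap.sub_apply, sub_eq_zero]
    exact hc h'
  obtain ⟨Φ, hΦ⟩ := exists_comp_eq_of_ker_le _ _ key
  obtain ⟨a, ha⟩ := hA Φ
  refine ⟨f a + b, fun h => ?_⟩
  have h1 : Φ (h ∘ₗ f) = Ψ h - h b := LinearMap.congr_fun hΦ h
  rw [map_add, ← sub_eq_iff_eq_add, ← h1, ha]
  rfl

theorem IsMatlisReflexive.of_injective {f : A →ₗ[R] B} (hf : Function.Injective f)
    (hB : IsMatlisReflexive R B) : IsMatlisReflexive R A :=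
  IsMatlisReflexive.of_exact (A := PUnit) (f := 0) (g := f)
    (fun x => by simpa [eq_comm] using map_eq_zero_iff f hf) .of_subsingleton hB

theorem IsMatlisReflexive.of_surjective {f : A →ₗ[R] B} (hf : Function.Surjective f)
    (hA : IsMatlisReflexive R A) : IsMatlisReflexive R B :=
  IsMatlisReflexive.of_exact (C := PUnit) (f := f) (g := 0)
    (fun x => by simpa using hf x) hA .of_subsingleton

theorem IsMatlisReflexive.dual (h : IsMatlisReflexive R L) :
    IsMatlisReflexive R (MatlisDual R L) :=
  isMatlisReflexive_iff.2 fun Ψ => ⟨Ψ ∘ₗ matlisBiduality R L, fun f => by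
    rw [isMatlisReflexive_iff] at h
    obtain ⟨x, hx⟩ := h f
    have : f = matlisBiduality R L x := LinearMap.ext hx
    rw [this]
    rfl⟩

theorem IsMatlisReflexive.pi_fin (h : IsMatlisReflexive R L) (n : ℕ) :
    IsMatlisReflexive R (Fin n → L) := by
  induction n with
  | zero => exact .of_subsingleton
  | succ n ih =>
    refine IsMatlisReflexive.of_exact (f := LinearMap.single R (fun _ : Fin (n + 1) => L) 0)
      (g := LinearMap.funLeft R L Fin.succ) (fun x => ?_) h ih
    constructor
    · intro hx
      refine ⟨x 0, funext fun i => ?_⟩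
      refine Fin.cases ?_ (fun j => ?_) i
      · simp
      · have := congrFun hx j
        simpa using this.symm
    · rintro ⟨y, rfl⟩
      ext j
      simp [LinearMap.funLeft]

end Cogenerator


/-! ### Finite length over a local ring -/

section FiniteLength

variable {R : Type u} [CommRing R]

/-- `L` has the same submodules over `R` and over `R ⧸ a`, and over an artinian ring noetherian and
artinian modules coincide. -/
theorem isFiniteLength_of_isArtinianRing_quotient {a : Ideal R} [IsArtinianRing (R ⧸ a)]
    {L : Type u} [AddCommGroup L] [Module R L] (ha : a ≤ Module.annihilator R L)
    (h : IsNoetherian R L ∨ IsArtinian R L) : IsFiniteLength R L := by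
  let : Module (R ⧸ a) L := Module.IsTorsionBySet.module (R := R) (M := L) (I := a)
    fun x r => Module.mem_annihilator.1 (ha r.2) x
  let e : L →ₛₗ[Ideal.Quotient.mk a] L :=
    { toFun := id, map_add' := fun _ _ => rfl, map_smul' := fun _ _ => rfl }
  have he : Function.Bijective e := Function.bijective_id
  rw [isFiniteLength_iff_isNoetherian_isArtinian, e.isNoetherian_iff_of_bijective he,
    e.isArtinian_iff_of_bijective he, ← IsSemiprimaryRing.isNoetherian_iff_isArtinian, and_self]
  rw [e.isNoetherian_iff_of_bijective he, e.isArtinian_iff_of_bijective he,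
    ← IsSemiprimaryRing.isNoetherian_iff_isArtinian, or_self] at h
  exact h

/-- An element of a module over a noetherian ring that is annihilated by some power of each
element of a finitely generated ideal is annihilated by a power of the ideal. -/
theorem exists_pow_smul_eq_zero_of_forall [IsNoetherianRing R] {L : Type u} [AddCommGroup L]
    [Module R L] {I : Ideal R} {x : L}
    (h : ∀ s ∈ I, ∃ n : ℕ, s ^ n • x = 0) : ∃ n : ℕ, ∀ r ∈ I ^ n, r • x = 0 := by
  obtain ⟨n, hn⟩ := Ideal.exists_pow_le_of_le_radical_of_fg
    (I := I) (J := Ideal.torsionOf R L x) (fun s hs => by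
      obtain ⟨n, hn⟩ := h s hs
      exact ⟨n, (Ideal.mem_torsionOf_iff x _).2 hn⟩) (IsNoetherian.noetherian I)
  exact ⟨n, fun r hr => (Ideal.mem_torsionOf_iff x r).1 (hn hr)⟩

variable [IsLocalRing R] {L : Type u} [AddCommGroup L] [Module R L]

open IsLocalRing

theorem isFiniteLength_of_maximalIdeal_le_annihilator
    (hL : maximalIdeal R ≤ Module.annihilator R L) (h : IsNoetherian R L ∨ IsArtinian R L) :
    IsFiniteLength R L :=
  haveI : IsArtinianRing (R ⧸ maximalIdeal R) :=
    inferInstanceAs (IsArtinianRing (ResidueField R))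
  isFiniteLength_of_isArtinianRing_quotient hL h

theorem isFiniteLength_quotient_of_pow_le [IsNoetherianRing R] {I : Ideal R} {n : ℕ}
    (hI : maximalIdeal R ^ n ≤ I) : IsFiniteLength R (R ⧸ I) := by
  have : IsArtinianRing (R ⧸ I) := by
    by_cases htop : I = ⊤
    · have : Subsingleton (R ⧸ I) := Ideal.Quotient.subsingleton_iff.2 htop
      infer_instance
    · refine quotient_artinian_of_mem_minimalPrimes_of_isLocalRing I
        ⟨⟨inferInstance, le_maximalIdeal htop⟩, fun J hJ _ => ?_⟩
      exact hJ.1.le_of_pow_le (hI.trans hJ.2)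
  exact isFiniteLength_of_isArtinianRing_quotient Ideal.annihilator_quotient.ge
    (.inl inferInstance)

/-- By essentiality some nonzero multiple `r • x` lies in the range; `r` is then a unit, as the
maximal ideal kills `x`. -/
theorem IsInjectiveHull.mem_range {E : Type u} [AddCommGroup E] [Module R E] {f : L →ₗ[R] E}
    (hf : IsInjectiveHull f) {x : E} (hx : ∀ r ∈ maximalIdeal R, r • x = 0) :
    x ∈ LinearMap.range f := by
  by_contra hne
  have hx0 : x ≠ 0 := fun h => hne (h ▸ zero_mem _)
  have hinf : Submodule.span R {x} ⊓ LinearMap.range f ≠ ⊥ := fun h =>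
    hx0 (Submodule.span_singleton_eq_bot.1 (hf.essential _ h))
  obtain ⟨y, ⟨hy, hyr⟩, hy0⟩ := (Submodule.ne_bot_iff _).1 hinf
  obtain ⟨r, rfl⟩ := Submodule.mem_span_singleton.1 hy
  have hr : IsUnit r := by
    by_contra hr
    exact hy0 (hx r ((mem_maximalIdeal r).2 hr))
  exact hne ((Submodule.smul_mem_iff_of_isUnit _ hr).1 hyr)

theorem mem_range_residueInjectiveHullMap {x : residueInjectiveHull R}
    (hx : ∀ r ∈ maximalIdeal R, r • x = 0) : x ∈ LinearMap.range (residueInjectiveHullMap R) :=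
  (isInjectiveHull_residueInjectiveHullMap R).mem_range hx

theorem smul_residueField_eq_zero {r : R} (hr : r ∈ maximalIdeal R) (c : ResidueField R) :
    r • c = 0 := by
  rw [Algebra.smul_def, ResidueField.algebraMap_eq, (residue_eq_zero_iff r).2 hr, zero_mul]

/-- `f 1` is killed by the maximal ideal, so it lies in the copy of `k` inside `E`. -/
theorem exists_eq_smul_residueInjectiveHullMap
    (f : ResidueField R →ₗ[R] residueInjectiveHull R) :
    ∃ r : R, f = r • residueInjectiveHullMap R := by
  obtain ⟨d, hd⟩ := mem_range_residueInjectiveHullMap (x := f 1) fun r hr => by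
    rw [← map_smul, smul_residueField_eq_zero hr, map_zero]
  obtain ⟨r, rfl⟩ := residue_surjective d
  have hs : ∀ s : R, residue R s = s • (1 : ResidueField R) := fun s => by
    rw [Algebra.smul_def, mul_one, ResidueField.algebraMap_eq]
  refine ⟨r, LinearMap.ext fun e => ?_⟩
  obtain ⟨s, rfl⟩ := residue_surjective e
  rw [hs s, map_smul, ← hd, hs r, map_smul, LinearMap.smul_apply, map_smul, smul_comm]

theorem isMatlisReflexive_residueField : IsMatlisReflexive R (ResidueField R) := by
  rw [isMatlisReflexive_iff]
  intro Ψ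
  obtain ⟨c, hc⟩ := mem_range_residueInjectiveHullMap (x := Ψ (residueInjectiveHullMap R))
    fun r hr => by
      rw [← map_smul, show r • residueInjectiveHullMap R = 0 from LinearMap.ext fun c => by
        rw [LinearMap.smul_apply, ← map_smul, smul_residueField_eq_zero hr, map_zero,
          LinearMap.zero_apply], map_zero]
  refine ⟨c, fun f => ?_⟩
  obtain ⟨r, rfl⟩ := exists_eq_smul_residueInjectiveHullMap f
  rw [map_smul, ← hc, LinearMap.smul_apply]

theorem IsFiniteLength.isMatlisReflexive (h : IsFiniteLength R L) : IsMatlisReflexive R L := by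
  induction h with
  | of_subsingleton => exact .of_subsingleton
  | @of_simple_quotient M _ _ N hN _ ih =>
    obtain ⟨I, hI, ⟨e⟩⟩ := isSimpleModule_iff_quot_maximal.1 hN
    obtain rfl := eq_maximalIdeal hI
    refine IsMatlisReflexive.of_exact (f := N.subtype) (g := N.mkQ)
      (LinearMap.exact_subtype_mkQ N) ih ?_
    exact isMatlisReflexive_residueField.of_surjective (f := e.symm.toLinearMap) e.symm.surjective

/-! ### Torsion and endomorphisms of the injective hull over a noetherian local ring. -/

variable [IsNoetherianRing R]

/-- For `s` in the maximal ideal the annihilators of `s ^ n • x` stabilize. If `s ^ n • x ≠ 0` at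
that stage, a nonzero multiple of it lies in `k`, hence is killed by `s`, contradicting stability.
-/
theorem exists_pow_smul_residueInjectiveHull_eq_zero (x : residueInjectiveHull R) :
    ∃ n : ℕ, ∀ r ∈ maximalIdeal R ^ n, r • x = 0 := by
  refine exists_pow_smul_eq_zero_of_forall fun s hs => ?_
  let I : ℕ →o Ideal R := ⟨fun n => Ideal.torsionOf R _ (s ^ n • x),
    monotone_nat_of_le_succ fun n r hr => by
      rw [Ideal.mem_torsionOf_iff] at hr ⊢
      rw [pow_succ', mul_smul, smul_comm, hr, smul_zero]⟩
  obtain ⟨n, hn⟩ := monotone_stabilizes_iff_noetherian.2 (inferInstanceAs (IsNoetherian R R)) I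
  refine ⟨n, ?_⟩
  by_contra h0
  have hinf : Submodule.span R {s ^ n • x} ⊓ LinearMap.range (residueInjectiveHullMap R) ≠ ⊥ :=
    fun h => h0 (Submodule.span_singleton_eq_bot.1
      ((isInjectiveHull_residueInjectiveHullMap R).essential _ h))
  obtain ⟨y, ⟨hy, c, hc⟩, hy0⟩ := (Submodule.ne_bot_iff _).1 hinf
  obtain ⟨r, rfl⟩ := Submodule.mem_span_singleton.1 hy
  have h1 : r ∈ I (n + 1) := by
    change r ∈ Ideal.torsionOf R _ (s ^ (n + 1) • x)
    rw [Ideal.mem_torsionOf_iff, pow_succ', mul_smul, smul_comm, ← hc, ← map_smul,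
      Algebra.smul_def, ResidueField.algebraMap_eq, (residue_eq_zero_iff s).2 hs, zero_mul,
      map_zero]
  rw [← hn (n + 1) n.le_succ] at h1
  exact hy0 ((Ideal.mem_torsionOf_iff _ r).1 h1)

/-- Endomorphisms of the injective hull of the residue field are locally given by scalars. -/
theorem exists_forall_apply_eq_smul (φ : residueInjectiveHull R →ₗ[R] residueInjectiveHull R)
    (n : ℕ) : ∃ r : R, ∀ x : residueInjectiveHull R,
      (∀ s ∈ maximalIdeal R ^ n, s • x = 0) → φ x = r • x := by
  have h := (isFiniteLength_quotient_of_pow_le (le_refl (maximalIdeal R ^ n))).isMatlisReflexive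
  rw [isMatlisReflexive_iff] at h
  -- Elements killed by `𝔪 ^ n` are the values at `1` of functionals on `R / 𝔪 ^ n`; a lift of `c`
  -- to `R` is the required scalar.
  obtain ⟨c, hc⟩ := h (φ ∘ₗ LinearMap.applyₗ (1 : R ⧸ maximalIdeal R ^ n))
  obtain ⟨r, rfl⟩ := Ideal.Quotient.mk_surjective c
  refine ⟨r, fun x hx => ?_⟩
  have hle : maximalIdeal R ^ n ≤ LinearMap.ker (LinearMap.toSpanSingleton R _ x) :=
    fun s hs => hx s hs
  have := hc (Submodule.liftQ _ _ hle)
  have h1 : ∀ s : R, Submodule.liftQ _ _ hle (Ideal.Quotient.mk _ s) = s • x := fun s => rfl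
  rw [h1] at this
  rw [← this, LinearMap.comp_apply, LinearMap.applyₗ_apply_apply]
  have h2 := h1 1
  rw [map_one, one_smul] at h2
  exact congrArg φ h2.symm

/-! ### Complete quotients -/

/-- On functionals `f` with `𝔪 ^ n` killing `f 1`, that is, those factoring through the finite
length module `R / (a + 𝔪 ^ n)`, `Ψ` is evaluation at some `r n`. These form a Cauchy sequence, and
its limit represents `Ψ` because every `f 1` is killed by a power of `𝔪`. -/
theorem isMatlisReflexive_quotient_of_isCompleteQuotient {a : Ideal R}
    (hc : IsCompleteQuotient R a) : IsMatlisReflexive R (R ⧸ a) := by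
  rw [isMatlisReflexive_iff]
  intro Ψ
  have hfin : ∀ n : ℕ, IsMatlisReflexive R (R ⧸ a ⊔ maximalIdeal R ^ n) := fun n =>
    (isFiniteLength_quotient_of_pow_le le_sup_right).isMatlisReflexive
  have hex : ∀ n : ℕ, ∃ r : R, ∀ f : (R ⧸ a) →ₗ[R] residueInjectiveHull R,
      (∀ s ∈ maximalIdeal R ^ n, s • f 1 = 0) → Ψ f = r • f 1 := by
    intro n
    obtain ⟨c, hc⟩ := (isMatlisReflexive_iff.1 (hfin n))
      (Ψ ∘ₗ LinearMap.lcomp R _ (Submodule.factor le_sup_left))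
    obtain ⟨r, rfl⟩ := Ideal.Quotient.mk_surjective c
    refine ⟨r, fun f hf => ?_⟩
    have hsm : ∀ s : R, f (Ideal.Quotient.mk a s) = s • f 1 := fun s => by
      rw [← map_smul, Algebra.smul_def, mul_one]
      rfl
    have hle : a ⊔ maximalIdeal R ^ n ≤ LinearMap.ker (f ∘ₗ Submodule.mkQ a) := by
      refine sup_le (fun s hs => ?_) fun s hs => ?_
      · have : Ideal.Quotient.mk a s = 0 := Ideal.Quotient.eq_zero_iff_mem.2 hs
        exact (congrArg f this).trans (map_zero f)
      · exact (hsm s).trans (hf s hs)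
    have := hc (Submodule.liftQ _ _ hle)
    rw [← hsm r]
    refine (congrArg Ψ (?_ : f = _)).trans this
    refine LinearMap.ext fun z => ?_
    obtain ⟨s, rfl⟩ := Ideal.Quotient.mk_surjective z
    rfl
  choose r hr using hex
  -- Functionals on `R / (a + 𝔪 ^ m)` separate its elements, and both `r m` and `r n` compute `Ψ` on
  -- them.
  have hcompat : ∀ {m n : ℕ}, m ≤ n → r m - r n ∈ a ⊔ maximalIdeal R ^ m := by
    intro m n hmn
    rw [← Ideal.Quotient.eq_zero_iff_mem]
    refine eq_zero_of_forall_apply_eq_zero (R := R) fun f => ?_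
    set g : (R ⧸ a) →ₗ[R] residueInjectiveHull R := f ∘ₗ Submodule.factor le_sup_left with hg
    have h1 : ∀ s : R, f (Ideal.Quotient.mk _ s) = s • g 1 := fun s => by
      rw [← map_smul, Algebra.smul_def, mul_one]
      rfl
    have h2 : ∀ s ∈ maximalIdeal R ^ m, s • g 1 = 0 := fun s hs => by
      rw [← h1, Ideal.Quotient.eq_zero_iff_mem.2 (Ideal.mem_sup_right hs), map_zero]
    rw [h1, sub_smul, ← hr m g h2, ← hr n g fun s hs => h2 s (Ideal.pow_le_pow_right hmn hs),
      sub_self]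
  have hmem : ∀ {m : ℕ} {s : R}, Ideal.Quotient.mk a s ∈
      (((maximalIdeal R).map (Ideal.Quotient.mk a)) ^ m • ⊤ : Submodule (R ⧸ a) (R ⧸ a)) ↔
      s ∈ a ⊔ maximalIdeal R ^ m := by
    intro m s
    rw [smul_eq_mul, Ideal.mul_top, ← Ideal.map_pow, ← Ideal.mem_comap,
      Ideal.comap_map_of_surjective _ Ideal.Quotient.mk_surjective, ← RingHom.ker_eq_comap_bot,
      Ideal.mk_ker, sup_comm]
  obtain ⟨c, hlim⟩ := hc.toIsPrecomplete.prec' (fun n => Ideal.Quotient.mk a (r n)) fun hmn => by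
    rw [SModEq.sub_mem, ← map_sub, hmem]
    exact hcompat hmn
  obtain ⟨t, rfl⟩ := Ideal.Quotient.mk_surjective c
  refine ⟨Ideal.Quotient.mk a t, fun f => ?_⟩
  obtain ⟨n, hn⟩ := exists_pow_smul_residueInjectiveHull_eq_zero (f 1)
  have hsm : ∀ s : R, f (Ideal.Quotient.mk a s) = s • f 1 := fun s => by
    rw [← map_smul, Algebra.smul_def, mul_one]
    rfl
  rw [hsm, hr n f hn, ← sub_eq_zero, ← sub_smul]
  have h1 := hlim n
  rw [SModEq.sub_mem, ← map_sub, hmem] at h1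
  obtain ⟨u, hu, v, hv, huv⟩ := Submodule.mem_sup.1 h1
  rw [← huv, add_smul, hn v hv, add_zero, ← hsm, Ideal.Quotient.eq_zero_iff_mem.2 hu, map_zero]

end FiniteLength


/-! ### Artinian modules and their Matlis duals -/

section Preliminaries

variable {R : Type u} [CommRing R] {a : Ideal R} {L : Type u} [AddCommGroup L] [Module R L]

/-- The action of `R ⧸ a` on a module annihilated by `a`. -/
noncomputable def quotientLSMul (ha : a ≤ Module.annihilator R L) :
    (R ⧸ a) →ₗ[R] L →ₗ[R] L :=
  Submodule.liftQ a (LinearMap.lsmul R L) fun _ hr =>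
    LinearMap.ext fun x => Module.mem_annihilator.1 (ha hr) x

theorem quotientLSMul_mk (ha : a ≤ Module.annihilator R L) (r : R) (x : L) :
    quotientLSMul ha (Ideal.Quotient.mk a r) x = r • x := rfl

theorem IsFiniteLength.of_exact {A B C : Type u} [AddCommGroup A] [Module R A] [AddCommGroup B]
    [Module R B] [AddCommGroup C] [Module R C] {f : A →ₗ[R] B} {g : B →ₗ[R] C}
    (hfg : Function.Exact f g) (hA : IsFiniteLength R A) (hC : IsFiniteLength R C) :
    IsFiniteLength R B := by
  rw [isFiniteLength_iff_isNoetherian_isArtinian] at hA hC ⊢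
  have := hA.1
  have := hA.2
  have := hC.1
  have := hC.2
  exact ⟨isNoetherian_of_range_eq_ker f g hfg.linearMap_ker_eq.symm,
    isArtinian_of_range_eq_ker f g hfg.linearMap_ker_eq.symm⟩

/-- The common kernel of a family of functionals on an artinian module is the common kernel of a
finite subfamily. -/
theorem exists_fin_forall_apply_eq_zero {A : Type u} [AddCommGroup A] [Module R A]
    [IsArtinian R A] {E : Type u} [AddCommGroup E] [Module R E]
    (W : Set (A →ₗ[R] E)) :
    ∃ (n : ℕ) (f : Fin n → A →ₗ[R] E), (∀ i, f i ∈ W) ∧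
      ∀ x, (∀ i, f i x = 0) → ∀ g ∈ W, g x = 0 := by
  obtain ⟨t, ht⟩ := Finset.exists_inf_le (fun g : W => LinearMap.ker g.1)
  refine ⟨t.card, fun i => (t.equivFin.symm i).1.1, fun i => (t.equivFin.symm i).1.2,
    fun x hx g hg => ht ⟨g, hg⟩ ?_⟩
  rw [Submodule.mem_finsetInf]
  intro w hw
  simpa using hx (t.equivFin ⟨w, hw⟩)

end Preliminaries

section Artinian

variable {R : Type u} [CommRing R] [IsLocalRing R]

open IsLocalRing

section

variable {A : Type u} [AddCommGroup A] [Module R A] [IsArtinian R A]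

variable (A) in
-- An artinian module thus embeds in a finite power of `E`: all functionals separate points, and the
-- descending chain condition selects finitely many.
theorem exists_fin_separating : ∃ (n : ℕ) (f : Fin n → A →ₗ[R] residueInjectiveHull R),
    ∀ x, (∀ i, f i x = 0) → x = 0 := by
  obtain ⟨n, f, -, hf⟩ := exists_fin_forall_apply_eq_zero (R := R) (A := A)
    (E := residueInjectiveHull R) Set.univ
  exact ⟨n, f, fun x hx => eq_zero_of_forall_apply_eq_zero fun g => hf x hx g trivial⟩

/-- A submodule of the Matlis dual of an artinian module that is stable under endomorphisms of
the injective hull is the annihilator of its annihilator. -/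
theorem mem_of_forall_apply_eq_zero {W : Submodule R (MatlisDual R A)}
    (hW : ∀ φ : Module.End R (residueInjectiveHull R), ∀ f ∈ W, φ ∘ₗ f ∈ W) {g : MatlisDual R A}
    (hg : ∀ x, (∀ f ∈ W, f x = 0) → g x = 0) : g ∈ W := by
  obtain ⟨n, f, hfW, hf⟩ := exists_fin_forall_apply_eq_zero (W : Set (MatlisDual R A))
  -- `g` factors through the map to `E ^ n` given by the `f i`; the components of `G` are
  -- endomorphisms of `E`, so `g` is a combination of the `f i` with coefficients that preserve `W`.
  obtain ⟨G, rfl⟩ := exists_comp_eq_of_ker_le (LinearMap.pi f) g fun x hx =>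
    hg x (hf x fun i => congrFun hx i)
  have : G ∘ₗ LinearMap.pi f =
      ∑ i, (G ∘ₗ LinearMap.single R (fun _ => (residueInjectiveHull R : Type u)) i) ∘ₗ f i := by
    ext x
    simp only [LinearMap.comp_apply, LinearMap.sum_apply]
    rw [← map_sum]
    exact congrArg G (LinearMap.sum_single_apply
      (fun _ : Fin n => (residueInjectiveHull R : Type u)) fun i => f i x).symm
  rw [this]
  exact Submodule.sum_mem _ fun i _ => hW _ _ (hfW i)

end

/-- A subquotient of the Matlis dual of an artinian module by submodules stable under
endomorphisms of the injective hull is the Matlis dual of an artinian module. -/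
theorem exists_quotient_equiv_dual {B : Type u} [AddCommGroup B] [Module R B] [IsArtinian R B]
    {H : Type u} [AddCommGroup H] [Module R H] {Θ : H →ₗ[R] MatlisDual R B}
    (hΘ : Function.Injective Θ) (V : Submodule R H)
    (hH : ∀ φ : Module.End R (residueInjectiveHull R), ∀ h, ∃ h', Θ h' = φ ∘ₗ Θ h)
    (hV : ∀ φ : Module.End R (residueInjectiveHull R), ∀ h ∈ V, ∃ h' ∈ V, Θ h' = φ ∘ₗ Θ h) :
    ∃ C : ModuleCat.{u} R, IsArtinian R C ∧ Nonempty ((H ⧸ V) ≃ₗ[R] MatlisDual R C) := by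
  -- `K₁ ≤ K₂` are the common zeros of `H` and of `V` in `B`; the module sought is `K₂ / K₁`.
  let K₁ : Submodule R B := ⨅ h, LinearMap.ker (Θ h)
  let K₂ : Submodule R B := ⨅ h ∈ V, LinearMap.ker (Θ h)
  have hK₁ : ∀ x, x ∈ K₁ ↔ ∀ h, Θ h x = 0 := fun x => by simp [K₁]
  have hK₂ : ∀ x, x ∈ K₂ ↔ ∀ h ∈ V, Θ h x = 0 := fun x => by simp [K₂]
  let C := K₂ ⧸ K₁.comap K₂.subtype
  have hle : ∀ h, K₁.comap K₂.subtype ≤ LinearMap.ker (Θ h ∘ₗ K₂.subtype) := fun h x hx =>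
    (hK₁ _).1 hx h
  let Γ : H →ₗ[R] MatlisDual R C :=
    { toFun := fun h => Submodule.liftQ _ (Θ h ∘ₗ K₂.subtype) (hle h)
      map_add' := fun h h' => by
        refine Submodule.linearMap_qext _ (LinearMap.ext fun x => ?_)
        simp
      map_smul' := fun r h => by
        refine Submodule.linearMap_qext _ (LinearMap.ext fun x => ?_)
        simp }
  have hΓ : ∀ h (x : K₂), Γ h (Submodule.Quotient.mk x) = Θ h x := fun h x => rfl
  have hker : LinearMap.ker Γ = V := by
    ext h
    rw [LinearMap.mem_ker]
    constructor
    · intro h0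
      have : Θ h ∈ V.map Θ := by
        refine mem_of_forall_apply_eq_zero ?_ fun x hx => ?_
        · rintro φ _ ⟨v, hv, rfl⟩
          obtain ⟨v', hv', h'⟩ := hV φ v hv
          exact ⟨v', hv', h'⟩
        · have hx2 : x ∈ K₂ := (hK₂ x).2 fun v hv => hx _ ⟨v, hv, rfl⟩
          rw [← hΓ h ⟨x, hx2⟩, h0, LinearMap.zero_apply]
      obtain ⟨v, hv, hvh⟩ := this
      rwa [← hΘ hvh]
    · intro hv
      refine Submodule.linearMap_qext _ (LinearMap.ext fun x => ?_)
      exact (hK₂ _).1 x.2 h hv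
  -- A functional on `K₂ / K₁` extends to `B` by injectivity of `E`; it vanishes on `K₁`, hence
  -- comes from `H` by the double annihilator property.
  have hsurj : Function.Surjective Γ := by
    intro c
    obtain ⟨g, hg⟩ := exists_comp_eq_of_ker_le K₂.subtype (c ∘ₗ Submodule.mkQ _) (by
      rw [Submodule.ker_subtype]; exact bot_le)
    obtain ⟨h, rfl⟩ : g ∈ LinearMap.range Θ := by
      refine mem_of_forall_apply_eq_zero ?_ fun x hx => ?_
      · rintro φ _ ⟨h, rfl⟩
        exact hH φ h
      · have hx1 : x ∈ K₁ := (hK₁ x).2 fun h => hx _ ⟨h, rfl⟩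
        have hx2 : x ∈ K₂ := (hK₂ x).2 fun h _ => (hK₁ x).1 hx1 h
        have := LinearMap.congr_fun hg ⟨x, hx2⟩
        exact this.trans
          ((congrArg c ((Submodule.Quotient.mk_eq_zero _).2 hx1)).trans (map_zero c))
    exact ⟨h, Submodule.linearMap_qext _ hg⟩
  exact ⟨ModuleCat.of R C, inferInstanceAs (IsArtinian R C),
    ⟨(Submodule.quotEquivOfEq _ _ hker.symm).trans (Γ.quotKerEquivOfSurjective hsurj)⟩⟩

section

variable [IsNoetherianRing R] {A : Type u} [AddCommGroup A] [Module R A] [IsArtinian R A]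

theorem IsArtinian.exists_pow_smul_eq_zero (x : A) :
    ∃ n : ℕ, ∀ r ∈ maximalIdeal R ^ n, r • x = 0 := by
  obtain ⟨n, f, hf⟩ := exists_fin_separating (R := R) A
  choose N hN using fun i => exists_pow_smul_residueInjectiveHull_eq_zero (f i x)
  refine ⟨Finset.univ.sup N, fun r hr => hf _ fun i => ?_⟩
  rw [map_smul]
  exact hN i r (Ideal.pow_le_pow_right (Finset.le_sup (Finset.mem_univ i)) hr)

variable (A) in
/-- Endomorphisms of the injective hull of the residue field act on artinian modules. -/
theorem exists_end_comp_eq (φ : Module.End R (residueInjectiveHull R)) :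
    ∃ ψ : Module.End R A, ∀ f : MatlisDual R A, f ∘ₗ ψ = φ ∘ₗ f := by
  obtain ⟨n, f, hf⟩ := exists_fin_separating (R := R) A
  let j : A →ₗ[R] Fin n → residueInjectiveHull R := LinearMap.pi f
  have hj : Function.Injective j := by
    rw [← LinearMap.ker_eq_bot, LinearMap.ker_eq_bot']
    exact fun x hx => hf x fun i => congrFun hx i
  -- A power of `𝔪` kills `x` and so every `g x`, where `φ` is a scalar not depending on `g`. Hence
  -- `φ`, applied coordinatewise, preserves the image of `A` in `E ^ n`.
  have hloc : ∀ x : A, ∃ r : R, ∀ g : MatlisDual R A, φ (g x) = g (r • x) := fun x => by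
    obtain ⟨N, hN⟩ := IsArtinian.exists_pow_smul_eq_zero (R := R) x
    obtain ⟨r, hr⟩ := exists_forall_apply_eq_smul φ N
    refine ⟨r, fun g => ?_⟩
    rw [map_smul]
    exact hr _ fun s hs => by rw [← map_smul, hN s hs, map_zero]
  have hrange : ∀ x, LinearMap.pi (fun i => φ ∘ₗ f i) x ∈ LinearMap.range j := fun x => by
    obtain ⟨r, hr⟩ := hloc x
    exact ⟨r • x, funext fun i => (hr (f i)).symm⟩
  let ψ : Module.End R A := (LinearEquiv.ofInjective j hj).symm.toLinearMap ∘ₗ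
    LinearMap.codRestrict (LinearMap.range j) (LinearMap.pi fun i => φ ∘ₗ f i) hrange
  have hψ : ∀ x, j (ψ x) = LinearMap.pi (fun i => φ ∘ₗ f i) x := fun x =>
    congrArg Subtype.val ((LinearEquiv.ofInjective j hj).apply_symm_apply ⟨_, hrange x⟩)
  refine ⟨ψ, fun g => LinearMap.ext fun x => ?_⟩
  obtain ⟨r, hr⟩ := hloc x
  have : ψ x = r • x := hj ((hψ x).trans (funext fun i => hr (f i)))
  exact (congrArg g this).trans (hr g).symm

end

/-- The socle of a module over a local ring: the elements annihilated by the maximal ideal. -/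
abbrev localSocle (R : Type u) [CommRing R] [IsLocalRing R] (X : Type u) [AddCommGroup X]
    [Module R X] : Submodule R X :=
  Submodule.torsionBySet R X (maximalIdeal R)

/-- Take `r` in the last power of the maximal ideal that does not kill `z`. -/
theorem exists_smul_mem_localSocle {X : Type u} [AddCommGroup X] [Module R X] {z : X} (hz : z ≠ 0)
    {n : ℕ} (hn : ∀ r ∈ maximalIdeal R ^ n, r • z = 0) :
    ∃ r : R, r • z ≠ 0 ∧ r • z ∈ localSocle R X := by
  induction n with
  | zero => exact absurd (by simpa using hn 1 (by simp)) hz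
  | succ n ih =>
    by_cases h : ∀ r ∈ maximalIdeal R ^ n, r • z = 0
    · exact ih h
    · push Not at h
      obtain ⟨r, hr, hrz⟩ := h
      refine ⟨r, hrz, (Submodule.mem_torsionBySet_iff _ _).2 fun s => ?_⟩
      rw [smul_smul]
      exact hn _ (by rw [pow_succ']; exact Ideal.mul_mem_mul s.2 hr)

/-- If `A` is artinian and `X` has an artinian socle, then the quotient of `Hom(A, X)` by an
`End(A)`-stable submodule is the Matlis dual of an artinian module. -/
theorem exists_hom_quotient_equiv_dual [IsNoetherianRing R] {A X : Type u} [AddCommGroup A]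
    [Module R A] [AddCommGroup X] [Module R X] [IsArtinian R A] [IsArtinian R (localSocle R X)]
    (V : Submodule R (A →ₗ[R] X)) (hV : ∀ ψ : Module.End R A, ∀ v ∈ V, v ∘ₗ ψ ∈ V) :
    ∃ C : ModuleCat.{u} R, IsArtinian R C ∧
      Nonempty (((A →ₗ[R] X) ⧸ V) ≃ₗ[R] MatlisDual R C) := by
  obtain ⟨n, f, hf⟩ := exists_fin_separating (R := R) (localSocle R X)
  choose h hh using fun i => exists_comp_eq_of_ker_le (localSocle R X).subtype (f i) (by
    rw [Submodule.ker_subtype]; exact bot_le)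
  -- The `h i` extend to `X` a separating family on the socle. `Θ` is injective: a nonzero `g x` is
  -- `𝔪`-power torsion like `x`, so it has a nonzero multiple in the socle, which some `h i`
  -- detects.
  let Θ : (A →ₗ[R] X) →ₗ[R] MatlisDual R (Fin n → A) :=
    { toFun := fun g => ∑ i, (h i ∘ₗ g) ∘ₗ LinearMap.proj i
      map_add' := fun g g' => by
        simp only [LinearMap.comp_add, LinearMap.add_comp, Finset.sum_add_distrib]
      map_smul' := fun r g => by
        simp only [LinearMap.comp_smul, LinearMap.smul_comp, Finset.smul_sum, RingHom.id_apply] }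
  have hΘ : ∀ g y, Θ g y = ∑ i, h i (g (y i)) := fun g y => LinearMap.sum_apply _ _ _
  -- This turns stability under endomorphisms of `A` into stability under endomorphisms of `E`.
  have hstable : ∀ (φ : Module.End R (residueInjectiveHull R)) (ψ : Module.End R A),
      (∀ f : MatlisDual R A, f ∘ₗ ψ = φ ∘ₗ f) → ∀ g, Θ (g ∘ₗ ψ) = φ ∘ₗ Θ g := by
    intro φ ψ hψ g
    refine LinearMap.ext fun y => ?_
    rw [hΘ, LinearMap.comp_apply, hΘ, map_sum]
    exact Finset.sum_congr rfl fun i _ => LinearMap.congr_fun (hψ (h i ∘ₗ g)) (y i)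
  refine exists_quotient_equiv_dual (Θ := Θ) ?_ V (fun φ g => ?_) fun φ g hg => ?_
  · rw [← LinearMap.ker_eq_bot, LinearMap.ker_eq_bot']
    intro g hg
    have h0 : ∀ i x, h i (g x) = 0 := fun i x => by
      have := hΘ g (Pi.single i x)
      rw [hg, LinearMap.zero_apply, Finset.sum_eq_single i, Pi.single_eq_same] at this
      · exact this.symm
      · intro k _ hk
        rw [Pi.single_eq_of_ne hk, map_zero, map_zero]
      · simp
    ext x
    by_contra hx
    obtain ⟨N, hN⟩ := IsArtinian.exists_pow_smul_eq_zero (R := R) x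
    obtain ⟨r, hr, hrs⟩ := exists_smul_mem_localSocle (R := R) (z := g x) hx fun s hs => by
      rw [← map_smul, hN s hs, map_zero]
    refine hr (congrArg Subtype.val (hf ⟨r • g x, hrs⟩ fun i => ?_))
    rw [← hh i]
    exact (map_smul (h i) r (g x)).trans (by rw [h0, smul_zero])
  · obtain ⟨ψ, hψ⟩ := exists_end_comp_eq A φ
    exact ⟨_, hstable φ ψ hψ g⟩
  · obtain ⟨ψ, hψ⟩ := exists_end_comp_eq A φ
    exact ⟨_, hV ψ g hg, hstable φ ψ hψ g⟩

/-! ### Noetherian and artinian modules over a complete quotient -/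

variable {a : Ideal R} {L : Type u} [AddCommGroup L] [Module R L]

variable [IsNoetherianRing R]

/-- `L` is a quotient of a finite power of `R ⧸ a`. -/
theorem isMatlisReflexive_of_isNoetherian (hc : IsCompleteQuotient R a)
    (ha : a ≤ Module.annihilator R L) [IsNoetherian R L] : IsMatlisReflexive R L := by
  obtain ⟨n, f, hf⟩ := Module.Finite.exists_fin' R L
  refine ((isMatlisReflexive_quotient_of_isCompleteQuotient hc).pi_fin n).of_surjective
    (f := ∑ i, (quotientLSMul ha).flip (f (Pi.single i 1)) ∘ₗ LinearMap.proj i) fun x => ?_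
  obtain ⟨y, rfl⟩ := hf x
  refine ⟨fun i => Ideal.Quotient.mk a (y i), ?_⟩
  rw [LinearMap.sum_apply, LinearMap.pi_apply_eq_sum_univ f y]
  refine Finset.sum_congr rfl fun i _ => ?_
  rw [LinearMap.comp_apply, LinearMap.proj_apply, LinearMap.flip_apply, quotientLSMul_mk]
  congr 2
  ext k
  simp [Pi.single_apply, eq_comm]

/-- `L` embeds in a finite power of the dual of `R ⧸ a` by sending `x` to the maps `s ↦ f i (s •
x)`. -/
theorem isMatlisReflexive_of_isArtinian (hc : IsCompleteQuotient R a)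
    (ha : a ≤ Module.annihilator R L) [IsArtinian R L] : IsMatlisReflexive R L := by
  obtain ⟨n, f, hf⟩ := exists_fin_separating (R := R) L
  refine ((isMatlisReflexive_quotient_of_isCompleteQuotient hc).dual.pi_fin n).of_injective
    (f := LinearMap.pi fun i => LinearMap.llcomp R _ _ _ (f i) ∘ₗ (quotientLSMul ha).flip) ?_
  rw [← LinearMap.ker_eq_bot, LinearMap.ker_eq_bot']
  refine fun x hx => hf x fun i => ?_
  have : f i (quotientLSMul ha (Ideal.Quotient.mk a 1) x) = 0 :=
    LinearMap.congr_fun (congrFun hx i) (Ideal.Quotient.mk a 1)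
  rwa [quotientLSMul_mk, one_smul] at this

/-! ### Matlis duals of modules of finite length. -/

theorem isFiniteLength_dual_residueField :
    IsFiniteLength R (MatlisDual R (ResidueField R)) := by
  refine isFiniteLength_of_maximalIdeal_le_annihilator (fun r hr => ?_) (.inl ?_)
  · rw [Module.mem_annihilator]
    exact fun f => LinearMap.ext fun c => by
      rw [LinearMap.smul_apply, ← map_smul, smul_residueField_eq_zero hr, map_zero,
        LinearMap.zero_apply]
  · refine isNoetherian_of_surjective
      (LinearMap.toSpanSingleton R _ (residueInjectiveHullMap R))
      (LinearMap.range_eq_top.2 fun f => ?_)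
    obtain ⟨r, rfl⟩ := exists_eq_smul_residueInjectiveHullMap f
    exact ⟨r, rfl⟩

theorem IsFiniteLength.dual (h : IsFiniteLength R L) : IsFiniteLength R (MatlisDual R L) := by
  induction h with
  | of_subsingleton => exact .of_subsingleton
  | @of_simple_quotient M _ _ N hN _ ih =>
    obtain ⟨I, hI, ⟨e⟩⟩ := isSimpleModule_iff_quot_maximal.1 hN
    obtain rfl := eq_maximalIdeal hI
    refine IsFiniteLength.of_exact (f := LinearMap.lcomp R (residueInjectiveHull R) N.mkQ)
      (g := LinearMap.lcomp R (residueInjectiveHull R) N.subtype) (fun f => ⟨fun hf => ?_, ?_⟩)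
      (isFiniteLength_dual_residueField.of_injective
        (f := LinearMap.lcomp R (residueInjectiveHull R) e.symm.toLinearMap) fun f g hfg => ?_) ih
    · have hle : N ≤ LinearMap.ker f := fun x hx => LinearMap.congr_fun hf ⟨x, hx⟩
      exact ⟨N.liftQ f hle, N.liftQ_mkQ f hle⟩
    · rintro ⟨g, rfl⟩
      refine LinearMap.ext fun x => ?_
      exact (congrArg g ((Submodule.Quotient.mk_eq_zero N).2 x.2)).trans (map_zero g)
    · refine LinearMap.ext fun x => ?_
      have := LinearMap.congr_fun hfg (e x)
      simpa using this

end Artinian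


/-! ### Exact sequences of Ext modules -/

section Ext

open CategoryTheory Abelian IsLocalRing

variable {R : Type u} [CommRing R]

theorem exact_ext_postcomp {S : ShortComplex (ModuleCat.{u} R)} (hS : S.ShortExact)
    (X : ModuleCat.{u} R) (i : ℕ) :
    Function.Exact ((Ext.mk₀ S.f).postcompOfLinear R X (add_zero i))
      ((Ext.mk₀ S.g).postcompOfLinear R X (add_zero i)) := fun x =>
  ⟨fun hx => Ext.covariant_sequence_exact₂ X hS x hx, by
    rintro ⟨y, rfl⟩
    change (y.comp (Ext.mk₀ S.f) (add_zero i)).comp (Ext.mk₀ S.g) (add_zero i) = 0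
    rw [Ext.comp_assoc_of_second_deg_zero, Ext.mk₀_comp_mk₀, S.zero, Ext.mk₀_zero, Ext.comp_zero]⟩

theorem exact_ext_precomp {S : ShortComplex (ModuleCat.{u} R)} (hS : S.ShortExact)
    (Y : ModuleCat.{u} R) (i : ℕ) :
    Function.Exact ((Ext.mk₀ S.g).precompOfLinear R Y (zero_add i))
      ((Ext.mk₀ S.f).precompOfLinear R Y (zero_add i)) := fun x =>
  ⟨fun hx => Ext.contravariant_sequence_exact₂ hS Y x hx, by
    rintro ⟨y, rfl⟩
    change (Ext.mk₀ S.f).comp ((Ext.mk₀ S.g).comp y (zero_add i)) (zero_add i) = 0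
    rw [Ext.mk₀_comp_mk₀_assoc, S.zero, Ext.mk₀_zero, Ext.zero_comp]⟩

theorem LinearMap.shortExact_of_injective_of_surjective {A B C : Type u} [AddCommGroup A]
    [Module R A] [AddCommGroup B] [Module R B] [AddCommGroup C] [Module R C] {f : A →ₗ[R] B}
    {g : B →ₗ[R] C} (hf : Function.Injective f) (hg : Function.Surjective g)
    (hfg : Function.Exact f g) :
    (ModuleCat.shortComplexOfCompEqZero f g hfg.linearMap_comp_eq_zero).ShortExact :=
  ModuleCat.shortComplex_shortExact _ hfg hf hg

/-- The identification of `Ext⁰` with the module of homomorphisms. -/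
noncomputable def extZeroEquiv (R : Type u) [CommRing R] (M X : Type u) [AddCommGroup M]
    [Module R M] [AddCommGroup X] [Module R X] : ExtModule R M X 0 ≃ₗ[R] (M →ₗ[R] X) :=
  Ext.linearEquiv₀.trans ModuleCat.homLinearEquiv

/-- `Hom(N, X)` embeds in a finite power of `X`; higher Ext modules are quotients of lower ones for
the kernel of a finite free cover. -/
theorem isArtinian_ext [IsNoetherianRing R] (N X : Type u) [AddCommGroup N] [Module R N]
    [AddCommGroup X] [Module R X] [Module.Finite R N] [IsArtinian R X] (i : ℕ) :
    IsArtinian R (ExtModule R N X i) := by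
  induction i generalizing N with
  | zero =>
    obtain ⟨n, f, hf⟩ := Module.Finite.exists_fin' R N
    have : IsArtinian R ((Fin n → R) →ₗ[R] X) :=
      (LinearMap.lsum R (fun _ : Fin n => R) R).isArtinian_iff.1 <|
        (LinearEquiv.piCongrRight fun _ : Fin n =>
          (LinearMap.ringLmapEquivSelf R R X).symm).isArtinian_iff.1 inferInstance
    exact isArtinian_of_injective
      (LinearMap.lcomp R X f ∘ₗ (extZeroEquiv R N X).toLinearMap)
      ((LinearMap.lcomp_injective_of_surjective f hf).comp (extZeroEquiv R N X).injective)
  | succ n ih =>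
    obtain ⟨F, _, _, _, _, f, hf⟩ := Module.exists_finite_presentation R N
    have hS := LinearMap.shortExact_shortComplexKer hf
    have := ih (LinearMap.ker f)
    exact isArtinian_of_surjective _ (hS.extClass.precompOfLinear R (ModuleCat.of R X)
      (add_comm 1 n)) (precomp_extClass_surjective_of_projective_X₂ (ModuleCat.of R X) hS n)

theorem annihilator_le_annihilator_submodule {M : Type u} [AddCommGroup M] [Module R M]
    (N : Submodule R M) : Module.annihilator R M ≤ Module.annihilator R N :=
  N.subtype.annihilator_le_of_injective N.injective_subtype

theorem annihilator_le_annihilator_quotient {M : Type u} [AddCommGroup M] [Module R M]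
    (N : Submodule R M) : Module.annihilator R M ≤ Module.annihilator R (M ⧸ N) :=
  N.mkQ.annihilator_le_of_surjective N.mkQ_surjective

variable [IsLocalRing R]

theorem maximalIdeal_le_annihilator_residueField :
    maximalIdeal R ≤ Module.annihilator R (ResidueField R) := fun r hr => by
  rw [Module.mem_annihilator]
  exact smul_residueField_eq_zero hr

theorem maximalIdeal_le_annihilator_ext (X : Type u) [AddCommGroup X] [Module R X] (i : ℕ) :
    maximalIdeal R ≤ Module.annihilator R (ExtModule R (ResidueField R) X i) :=
  (maximalIdeal_le_annihilator_residueField.trans le_sup_left).trans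
    (annihilator_sup_le_annihilator_ext R _ X i)

/-- Finiteness of the Bass numbers of `X`, the only property of `X` needed to describe Ext from an
artinian module into it. -/
theorem isArtinian_ext_residueField [IsNoetherianRing R] (X : Type u) [AddCommGroup X]
    [Module R X] (hX : IsNoetherian R X ∨ IsArtinian R X) (i : ℕ) :
    IsArtinian R (ExtModule R (ResidueField R) X i) := by
  have hfin : Module.Finite R (ResidueField R) :=
    inferInstanceAs (Module.Finite R (R ⧸ maximalIdeal R))
  rcases hX with hX | hX
  · have : Module.Finite R (ModuleCat.of R (ResidueField R)) := hfin
    have : Module.Finite R (ModuleCat.of R X) := inferInstanceAs (Module.Finite R X)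
    have : Module.Finite R (ExtModule R (ResidueField R) X i) :=
      ModuleCat.finite_ext R (ModuleCat.of R (ResidueField R)) (ModuleCat.of R X) i
    exact (isFiniteLength_iff_isNoetherian_isArtinian.1
      (isFiniteLength_of_maximalIdeal_le_annihilator (maximalIdeal_le_annihilator_ext X i)
        (.inl inferInstance))).2
  · exact isArtinian_ext _ X i

theorem isArtinian_localSocle (X : Type u) [AddCommGroup X] [Module R X]
    [IsArtinian R (ExtModule R (ResidueField R) X 0)] : IsArtinian R (localSocle R X) := by
  have h1 : IsArtinian R (ResidueField R →ₗ[R] X) :=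
    (extZeroEquiv R (ResidueField R) X).isArtinian_iff.1 inferInstance
  refine isArtinian_of_surjective (R := R) (ResidueField R →ₗ[R] X)
    (LinearMap.codRestrict _ (LinearMap.applyₗ (1 : ResidueField R)) fun f => ?_) fun x => ?_
  · rw [Submodule.mem_torsionBySet_iff]
    intro r
    rw [LinearMap.applyₗ_apply_apply]
    exact (map_smul f r.1 1).symm.trans (by rw [smul_residueField_eq_zero r.2, map_zero])
  · have hle : maximalIdeal R ≤ LinearMap.ker (LinearMap.toSpanSingleton R X x) := fun r hr =>
      (Submodule.mem_torsionBySet_iff _ _).1 x.2 ⟨r, hr⟩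
    exact ⟨Submodule.liftQ _ _ hle, Subtype.ext (one_smul R x.1)⟩

/-! ### Ext modules out of an artinian module -/

/-- Every module over a local ring with artinian modules `Extʲ(k, X)` embeds into an injective
module such that the cokernel has the same property. -/
theorem exists_shortExact_isArtinian_ext {X : Type u} [AddCommGroup X] [Module R X]
    (hX : ∀ j, IsArtinian R (ExtModule R (ResidueField R) X j)) :
    ∃ (I X' : ModuleCat.{u} R) (f : X →ₗ[R] I) (g : I →ₗ[R] X') (hfg : Function.Exact f g),
      (ModuleCat.shortComplexOfCompEqZero f g hfg.linearMap_comp_eq_zero).ShortExact ∧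
      Module.Injective R I ∧ ∀ j, IsArtinian R (ExtModule R (ResidueField R) X' j) := by
  obtain ⟨I, f, hf⟩ := exists_isInjectiveHull R X
  let g : I →ₗ[R] (I ⧸ LinearMap.range f) := (LinearMap.range f).mkQ
  have hfg : Function.Exact f g := LinearMap.exact_map_mkQ_range f
  have hS := LinearMap.shortExact_of_injective_of_surjective hf.injective
    (Submodule.mkQ_surjective _) hfg
  refine ⟨I, ModuleCat.of R (I ⧸ LinearMap.range f), f, g, hfg, hS, hf.injective_module,
    fun j => ?_⟩
  have := hX (j + 1)
  refine isArtinian_of_injective (hS.extClass.postcompOfLinear R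
    (ModuleCat.of R (ResidueField R)) (rfl : j + 1 = j + 1)) ?_
  rw [← LinearMap.ker_eq_bot, LinearMap.ker_eq_bot']
  intro x hx
  obtain ⟨y, rfl⟩ := Ext.covariant_sequence_exact₃ (ModuleCat.of R (ResidueField R)) hS x rfl hx
  cases j with
  | zero =>
    -- `Hom(k, I)` need not vanish, but the image of `k` in the hull `I` lies in `X`, so it dies in
    -- `X'`. An arbitrary injective embedding would not do here.
    obtain ⟨h, rfl⟩ := (Ext.mk₀_bijective _ _).2 y
    rw [Ext.mk₀_comp_mk₀, Ext.mk₀_eq_zero_iff]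
    ext c
    refine (hfg (h.hom c)).2 (hf.mem_range fun r hr => ?_)
    exact (map_smul h.hom r c).symm.trans (by rw [smul_residueField_eq_zero hr, map_zero])
  | succ j =>
    have := hf.injective_module
    have : Injective (ModuleCat.of R I) := Module.injective_object_of_injective_module R I
    rw [Ext.eq_zero_of_injective y, Ext.zero_comp]

variable [IsNoetherianRing R]

/-- Embed `X` in its injective hull with cokernel `X'`, which inherits `hX`. Then `Ext^1(A, X)` is a
quotient of `Hom(A, X')` by a stable submodule, and `Ext^(i+2)(A, X)` is `Ext^(i+1)(A, X')`. -/
theorem exists_ext_equiv_dual {A X : Type u} [AddCommGroup A] [Module R A] [AddCommGroup X]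
    [Module R X] [IsArtinian R A] (hX : ∀ j, IsArtinian R (ExtModule R (ResidueField R) X j))
    (i : ℕ) :
    ∃ C : ModuleCat.{u} R, IsArtinian R C ∧ Nonempty (ExtModule R A X i ≃ₗ[R] MatlisDual R C) := by
  induction i generalizing X with
  | zero =>
    have := hX 0
    have := isArtinian_localSocle (R := R) X
    obtain ⟨C, hC, ⟨e⟩⟩ := exists_hom_quotient_equiv_dual (R := R) (A := A) (X := X) ⊥ (by
      rintro ψ v rfl
      exact LinearMap.zero_comp ψ)
    exact ⟨C, hC, ⟨(extZeroEquiv R A X).trans ((Submodule.quotEquivOfEqBot _ rfl).symm.trans e)⟩⟩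
  | succ i ih =>
    obtain ⟨I, X', f, g, hfg, hS, hI, hX'⟩ := exists_shortExact_isArtinian_ext hX
    have hI' : Injective (ModuleCat.of R I) := Module.injective_object_of_injective_module R I
    let δ : ExtModule R A X' i →ₗ[R] ExtModule R A X (i + 1) :=
      hS.extClass.postcompOfLinear R (ModuleCat.of R A) (rfl : i + 1 = i + 1)
    have hδ : Function.Surjective δ := fun x =>
      Ext.covariant_sequence_exact₁ _ hS x (Ext.eq_zero_of_injective _) rfl
    cases i with
    | zero =>
      have := hX' 0
      have := isArtinian_localSocle (R := R) X'
      let δ' : (A →ₗ[R] X') →ₗ[R] ExtModule R A X 1 :=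
        δ ∘ₗ (extZeroEquiv R A X').symm.toLinearMap
      -- The kernel is stable under endomorphisms of `A` by associativity of the Yoneda product.
      obtain ⟨C, hC, ⟨e⟩⟩ := exists_hom_quotient_equiv_dual (LinearMap.ker δ') (by
        intro ψ v hv
        have hv' : (Ext.mk₀ (ModuleCat.ofHom v)).comp hS.extClass (zero_add 1) = 0 := hv
        change (Ext.mk₀ (ModuleCat.ofHom ψ ≫ ModuleCat.ofHom v)).comp hS.extClass (zero_add 1) = 0
        rw [← Ext.mk₀_comp_mk₀_assoc, hv', Ext.comp_zero])
      exact ⟨C, hC, ⟨(δ'.quotKerEquivOfSurjective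
        (hδ.comp (extZeroEquiv R A X').symm.surjective)).symm.trans e⟩⟩
    | succ i =>
      obtain ⟨C, hC, ⟨e⟩⟩ := ih hX'
      have hδ' : Function.Injective δ := by
        rw [← LinearMap.ker_eq_bot, LinearMap.ker_eq_bot']
        intro x hx
        obtain ⟨y, rfl⟩ := Ext.covariant_sequence_exact₃ _ hS x rfl hx
        rw [Ext.eq_zero_of_injective y, Ext.zero_comp]
      exact ⟨C, hC, ⟨(LinearEquiv.ofBijective δ ⟨hδ', hδ⟩).symm.trans e⟩⟩

/-! ### Ext modules of mini-max modules -/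

/-- A property of modules that holds for the noetherian and the artinian modules annihilated by
`a` and the Matlis duals of the latter, and that passes to the middle term of exact sequences,
holds for the Ext modules of mini-max modules whose annihilators add up to an ideal above `a`. -/
theorem ext_of_isMiniMax {a : Ideal R}
    {P : ∀ (L : Type u) [AddCommGroup L] [Module R L], Prop}
    (exact : ∀ {A B C : Type u} [AddCommGroup A] [Module R A] [AddCommGroup B] [Module R B]
      [AddCommGroup C] [Module R C] {f : A →ₗ[R] B} {g : B →ₗ[R] C},
      Function.Exact f g → P A → P C → P B)
    (noetherian : ∀ (L : Type u) [AddCommGroup L] [Module R L], IsNoetherian R L →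
      a ≤ Module.annihilator R L → P L)
    (artinian : ∀ (L : Type u) [AddCommGroup L] [Module R L], IsArtinian R L →
      a ≤ Module.annihilator R L → P L)
    (dual : ∀ (L : Type u) [AddCommGroup L] [Module R L], IsArtinian R L →
      a ≤ Module.annihilator R L → P (MatlisDual R L))
    {M M' : Type u} [AddCommGroup M] [Module R M] [AddCommGroup M'] [Module R M']
    (hM : IsMiniMax R M) (hM' : IsMiniMax R M')
    (ha : a ≤ Module.annihilator R M ⊔ Module.annihilator R M') (i : ℕ) :
    P (ExtModule R M M' i) := by
  have h1 : ∀ (M M' : Type u) [AddCommGroup M] [Module R M] [AddCommGroup M'] [Module R M'],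
      IsNoetherian R M ∨ IsArtinian R M → IsNoetherian R M' ∨ IsArtinian R M' →
      a ≤ Module.annihilator R M ⊔ Module.annihilator R M' → P (ExtModule R M M' i) := by
    intro M M' _ _ _ _ hM hM' ha
    have ha' := ha.trans (annihilator_sup_le_annihilator_ext R M M' i)
    rcases hM with hM | hM
    · rcases hM' with hM' | hM'
      · have : Module.Finite R (ModuleCat.of R M) := inferInstanceAs (Module.Finite R M)
        have : Module.Finite R (ModuleCat.of R M') := inferInstanceAs (Module.Finite R M')
        have : Module.Finite R (ExtModule R M M' i) :=
          ModuleCat.finite_ext R (ModuleCat.of R M) (ModuleCat.of R M') i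
        exact noetherian _ inferInstance ha'
      · exact artinian _ (isArtinian_ext M M' i) ha'
    · obtain ⟨C, hC, ⟨e⟩⟩ := exists_ext_equiv_dual (A := M) (isArtinian_ext_residueField M' hM') i
      -- `a` kills the dual of `C`, and functionals separate the points of `C`.
      have hCa : a ≤ Module.annihilator R C :=
        (ha'.trans e.annihilator_eq.le).trans annihilator_dual_le
      -- Invariance of `P` under isomorphism is extracted from `exact` with a zero module on the
      -- left.
      refine exact (A := PUnit) (f := 0) (g := e.toLinearMap)
        (fun x => by simpa [eq_comm] using map_eq_zero_iff e e.injective) ?_ (dual C hC hCa)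
      exact noetherian _ inferInstance (fun r _ =>
        Module.mem_annihilator.2 fun x => Subsingleton.elim _ _)
  have h2 : ∀ (M : Type u) [AddCommGroup M] [Module R M],
      IsNoetherian R M ∨ IsArtinian R M →
      a ≤ Module.annihilator R M ⊔ Module.annihilator R M' → P (ExtModule R M M' i) := by
    intro M _ _ hM ha
    obtain ⟨N, hN, hN'⟩ := hM'
    have hS := LinearMap.shortExact_of_injective_of_surjective N.injective_subtype
      N.mkQ_surjective (LinearMap.exact_subtype_mkQ N)
    exact exact (exact_ext_postcomp hS (ModuleCat.of R M) i)
      (h1 M N hM (.inl hN) (ha.trans (sup_le_sup_left (annihilator_le_annihilator_submodule N) _)))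
      (h1 M (M' ⧸ N) hM (.inr hN')
        (ha.trans (sup_le_sup_left (annihilator_le_annihilator_quotient N) _)))
  obtain ⟨N, hN, hN'⟩ := hM
  have hS := LinearMap.shortExact_of_injective_of_surjective N.injective_subtype
    N.mkQ_surjective (LinearMap.exact_subtype_mkQ N)
  exact exact (exact_ext_precomp hS (ModuleCat.of R M') i)
    (h2 (M ⧸ N) (.inr hN')
      (ha.trans (sup_le_sup_right (annihilator_le_annihilator_quotient N) _)))
    (h2 N (.inl hN) (ha.trans (sup_le_sup_right (annihilator_le_annihilator_submodule N) _)))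

end Ext


/-! ### Matlis reflexivity and surjective ring homomorphisms -/

section ChangeOfRings

open IsLocalRing

variable {T S : Type u} [CommRing T] [CommRing S] [Algebra T S]

/-- The kernel of `T → S` kills `L`, so `f` lands in the part of `E` it kills, which `j` identifies
with a submodule of `F`; surjectivity makes `T`-linear maps `S`-linear. -/
theorem exists_linearMap_comp_eq (hs : Function.Surjective (algebraMap T S)) {L E F : Type u}
    [AddCommGroup L] [Module T L] [Module S L] [IsScalarTower T S L] [AddCommGroup E] [Module T E]
    [AddCommGroup F] [Module T F] [Module S F] [IsScalarTower T S F] {j : F →ₗ[T] E}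
    (hj : Function.Injective j)
    (hr : ∀ x, (∀ t, algebraMap T S t = 0 → t • x = 0) → x ∈ LinearMap.range j) (f : L →ₗ[T] E) :
    ∃ g : L →ₗ[S] F, ∀ x, j (g x) = f x := by
  have hf : ∀ x, f x ∈ LinearMap.range j := fun x => hr _ fun t ht => by
    rw [← map_smul, ← algebraMap_smul S t x, ht, zero_smul, map_zero]
  let g : L →ₗ[T] F :=
    (LinearEquiv.ofInjective j hj).symm.toLinearMap ∘ₗ f.codRestrict (LinearMap.range j) hf
  exact ⟨g.extendScalarsOfSurjective hs, fun x =>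
    congrArg Subtype.val ((LinearEquiv.ofInjective j hj).apply_symm_apply ⟨f x, hf x⟩)⟩

variable [IsLocalRing T] [IsLocalRing S]

/-- An injective hull of the residue field over a quotient ring of `T` is the submodule of the
injective hull over `T` on which the kernel vanishes. -/
theorem IsInjectiveHull.exists_linearMap_residueInjectiveHull
    (hs : Function.Surjective (algebraMap T S)) {F : Type u} [AddCommGroup F] [Module S F]
    [Module T F] [IsScalarTower T S F] {f : ResidueField S →ₗ[S] F} (hf : IsInjectiveHull f) :
    ∃ j : F →ₗ[T] residueInjectiveHull T, Function.Injective j ∧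
      ∀ x, (∀ t, algebraMap T S t = 0 → t • x = 0) → x ∈ LinearMap.range j := by
  have hlocal : IsLocalHom (algebraMap T S) := IsLocalHom.of_surjective _ hs
  have hres : ∀ {A : Type u} [CommRing A] [IsLocalRing A] {N : Type u} [AddCommGroup N]
      [Module A N] (g : ResidueField A →ₗ[A] N) (a : A), g (residue A a) = a • g 1 := by
    intro A _ _ N _ _ g a
    rw [← map_smul, Algebra.smul_def, mul_one, ResidueField.algebraMap_eq]
  let p : T →ₗ[T] F := LinearMap.toSpanSingleton T F (f 1)
  let q : T →ₗ[T] residueInjectiveHull T :=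
    LinearMap.toSpanSingleton T _ (residueInjectiveHullMap T 1)
  have hp : ∀ t, p t = f (residue S (algebraMap T S t)) := fun t => by
    rw [hres f, algebraMap_smul]
    rfl
  have hq : ∀ t, q t = residueInjectiveHullMap T (residue T t) := fun t => (hres _ t).symm
  have hp0 : ∀ t, p t = 0 ↔ t ∈ maximalIdeal T := fun t => by
    rw [hp, map_eq_zero_iff f hf.injective, residue_eq_zero_iff, mem_maximalIdeal,
      mem_maximalIdeal, mem_nonunits_iff, mem_nonunits_iff, isUnit_map_iff]
  have hq0 : ∀ t, q t = 0 ↔ t ∈ maximalIdeal T := fun t => by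
    rw [hq, map_eq_zero_iff _ (isInjectiveHull_residueInjectiveHullMap T).injective,
      residue_eq_zero_iff]
  -- `p` and `q` cover the residue fields in the two hulls and have the same kernel, so `j` is
  -- injective on the residue field of `S` and, by essentiality, everywhere.
  obtain ⟨j, hj⟩ := exists_comp_eq_of_ker_le p q fun t ht => (hq0 t).2 ((hp0 t).1 ht)
  have hjp : ∀ t, j (p t) = q t := fun t => LinearMap.congr_fun hj t
  have hjinj : Function.Injective j := by
    let K : Submodule S F :=
      { carrier := {x | j x = 0}
        add_mem' := fun {x y} hx hy => by
          change j (x + y) = 0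
          rw [map_add, show j x = 0 from hx, show j y = 0 from hy, add_zero]
        zero_mem' := map_zero j
        smul_mem' := fun s x hx => by
          obtain ⟨t, rfl⟩ := hs s
          change j (algebraMap T S t • x) = 0
          rw [algebraMap_smul, map_smul, show j x = 0 from hx, smul_zero] }
    have hK : K = ⊥ := hf.essential K <| by
      rw [eq_bot_iff]
      rintro _ ⟨hx, c, rfl⟩
      obtain ⟨s, rfl⟩ := residue_surjective c
      obtain ⟨t, rfl⟩ := hs s
      rw [Submodule.mem_bot, ← hp, hp0, ← hq0, ← hjp, hp]
      exact hx
    rw [← LinearMap.ker_eq_bot, LinearMap.ker_eq_bot']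
    intro x hx
    have : x ∈ K := hx
    rwa [hK] at this
  refine ⟨j, hjinj, fun x hx => ?_⟩
  let N := Submodule.torsionBySet T (residueInjectiveHull T) (RingHom.ker (algebraMap T S))
  let e := RingHom.quotientKerEquivOfSurjective hs
  let : Module S N := Module.compHom N e.symm.toRingHom
  have htower : ∀ (t : T) (y : N), algebraMap T S t • y = t • y := fun t y => by
    change e.symm (algebraMap T S t) • y = t • y
    have : e.symm (algebraMap T S t) = Ideal.Quotient.mk _ t := e.symm_apply_eq.2 rfl
    rw [this]
    rfl
  have : IsScalarTower T S N := IsScalarTower.of_algebraMap_smul htower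
  have hjN : ∀ y, j y ∈ N := fun y => (Submodule.mem_torsionBySet_iff _ _).2 fun t => by
    have ht : algebraMap T S t = 0 := t.2
    rw [← map_smul, ← algebraMap_smul S t.1 y, ht, zero_smul, map_zero]
  let j' : F →ₗ[S] N := (j.codRestrict N hjN).extendScalarsOfSurjective hs
  have hj' : ∀ y, (j' y : residueInjectiveHull T) = j y := fun y => rfl
  -- `F` is injective over `S`, so `j'` splits. The copy of the residue field in the hull over `T`
  -- lies in the image of `j'`, where `ρ` is injective; by essentiality `ρ` is injective on `N`, so
  -- `j'` is onto.
  obtain ⟨ρ, hρ⟩ := hf.injective_module.out j'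
    (fun y z h => hjinj (congrArg Subtype.val h)) LinearMap.id
  have hρker : ∀ y : N, ρ y = 0 → y = 0 := by
    let K : Submodule T (residueInjectiveHull T) :=
      (LinearMap.ker (ρ.restrictScalars T)).map N.subtype
    have hK : K = ⊥ := (isInjectiveHull_residueInjectiveHullMap T).essential K <| by
      rw [eq_bot_iff]
      rintro _ ⟨⟨y, hy, rfl⟩, c, hc⟩
      obtain ⟨t, rfl⟩ := residue_surjective c
      rw [← hq, ← hjp, ← hj'] at hc
      have hy' : y = j' (p t) := Subtype.ext hc.symm
      have h0 : p t = 0 := (hρ (p t)).symm.trans ((congrArg ρ hy').symm.trans hy)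
      rw [hy', h0, map_zero]
      exact zero_mem _
    intro y hy
    have : (y : residueInjectiveHull T) ∈ K := ⟨y, hy, rfl⟩
    rw [hK, Submodule.mem_bot] at this
    exact Subtype.ext this
  let y : N := ⟨x, (Submodule.mem_torsionBySet_iff _ _).2 fun t => hx t t.2⟩
  refine ⟨ρ y, ?_⟩
  have h := hρker (j' (ρ y) - y) (by rw [map_sub, hρ, LinearMap.id_apply, sub_self])
  exact congrArg Subtype.val (sub_eq_zero.1 h)

/-- Composition with `j` identifies the `S`-dual of `L` with its `T`-dual, and likewise the double
duals. No noetherian hypothesis enters, so the completion may serve as `T`. -/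
theorem isMatlisReflexive_iff_of_surjective (hs : Function.Surjective (algebraMap T S))
    {L : Type u} [AddCommGroup L] [Module T L] [Module S L] [IsScalarTower T S L] :
    IsMatlisReflexive T L ↔ IsMatlisReflexive S L := by
  let : Module T (residueInjectiveHull S) := Module.compHom _ (algebraMap T S)
  have : IsScalarTower T S (residueInjectiveHull S) :=
    IsScalarTower.of_algebraMap_smul fun _ _ => rfl
  obtain ⟨j, hj, hr⟩ := (isInjectiveHull_residueInjectiveHullMap
    S).exists_linearMap_residueInjectiveHull hs
  let Φ : MatlisDual S L →ₗ[T] MatlisDual T L :=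
    { toFun := fun g => j ∘ₗ g.restrictScalars T
      map_add' := fun g g' => LinearMap.ext fun x => map_add j (g x) (g' x)
      map_smul' := fun t g => LinearMap.ext fun x => map_smul j t (g x) }
  have hΦ : Function.Bijective Φ := by
    refine ⟨fun g g' h => LinearMap.ext fun x => hj (LinearMap.congr_fun h x), fun f => ?_⟩
    obtain ⟨g, hg⟩ := exists_linearMap_comp_eq hs hj hr f
    exact ⟨g, LinearMap.ext hg⟩
  rw [isMatlisReflexive_iff, isMatlisReflexive_iff]
  constructor
  · intro h Ψ
    let e := LinearEquiv.ofBijective Φ hΦ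
    obtain ⟨x, hx⟩ := h (j ∘ₗ Ψ.restrictScalars T ∘ₗ e.symm.toLinearMap)
    exact ⟨x, fun g => hj ((congrArg (fun g' => j (Ψ g')) (e.symm_apply_apply g).symm).trans
      (hx (e g)))⟩
  · intro h Ψ
    obtain ⟨Ψ', hΨ'⟩ := exists_linearMap_comp_eq hs hj hr (Ψ ∘ₗ Φ)
    obtain ⟨x, hx⟩ := h Ψ'
    refine ⟨x, fun f => ?_⟩
    obtain ⟨g, rfl⟩ := hΦ.2 f
    exact (hΨ' g).symm.trans (congrArg j (hx g))

end ChangeOfRings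

/-! ### The theorem on Ext of mini-max modules. -/

theorem mainTheorem6 (R : Type u) [CommRing R] [IsNoetherianRing R] [IsLocalRing R]
    (M M' : Type u) [AddCommGroup M] [Module R M] [AddCommGroup M'] [Module R M']
    (hM : IsMiniMax R M) (hM' : IsMiniMax R M') (i : ℕ) :
    (∀ hc : IsCompleteQuotient R (Module.annihilator R M ⊔ Module.annihilator R M'),
      IsMatlisReflexive R (ExtModule R M M' i) ∧
      (letI : Module (LocalCompletion R) (ExtModule R M M' i) :=
        completionModule hc (ExtModule R M M' i) (annihilator_sup_le_annihilator_ext R M M' i)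
       IsMatlisReflexive (LocalCompletion R) (ExtModule R M M' i))) ∧
    (IsArtinianRing (R ⧸ (Module.annihilator R M ⊔ Module.annihilator R M')) →
      IsFiniteLength R (ExtModule R M M' i)) := by
  have ha := annihilator_sup_le_annihilator_ext R M M' i
  refine ⟨fun hc => ?_, fun hart => ?_⟩
  · have hR : IsMatlisReflexive R (ExtModule R M M' i) :=
      ext_of_isMiniMax (P := fun L _ _ => IsMatlisReflexive R L)
        (fun hfg hA hC => hA.of_exact hfg hC)
        (fun L _ _ _ hL => isMatlisReflexive_of_isNoetherian hc hL)
        (fun L _ _ _ hL => isMatlisReflexive_of_isArtinian hc hL)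
        (fun L _ _ _ hL => (isMatlisReflexive_of_isArtinian hc hL).dual) hM hM' le_rfl i
    refine ⟨hR, ?_⟩
    set a := Module.annihilator R M ⊔ Module.annihilator R M'
    let := completionModule hc (ExtModule R M M' i) ha
    -- The zero ring is not local, so `a = ⊤` is set apart; Ext then vanishes.
    by_cases htop : a = ⊤
    · have : Subsingleton (ExtModule R M M' i) :=
        Module.annihilator_eq_top_iff.1 (top_le_iff.1 (htop.ge.trans ha))
      exact .of_subsingleton
    · have : Nontrivial (R ⧸ a) := Ideal.Quotient.nontrivial_iff.2 htop
      have : IsLocalRing (R ⧸ a) :=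
        .of_surjective' (Ideal.Quotient.mk a) Ideal.Quotient.mk_surjective
      let : Module (R ⧸ a) (ExtModule R M M' i) :=
        Module.IsTorsionBySet.module (R := R) (M := ExtModule R M M' i) (I := a)
          fun x r => Module.mem_annihilator.1 (ha r.2) x
      have : IsScalarTower R (R ⧸ a) (ExtModule R M M' i) :=
        IsScalarTower.of_algebraMap_smul fun _ _ => rfl
      let : Algebra (LocalCompletion R) (R ⧸ a) := (completionToQuotient hc).toAlgebra
      have : IsScalarTower (LocalCompletion R) (R ⧸ a) (ExtModule R M M' i) :=
        IsScalarTower.of_algebraMap_smul fun _ _ => rfl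
      have hs : Function.Surjective (algebraMap (LocalCompletion R) (R ⧸ a)) := fun x => by
        obtain ⟨r, rfl⟩ := Ideal.Quotient.mk_surjective x
        exact ⟨_, completionToQuotient_algebraMap hc r⟩
      -- Reflexivity descends from `R` to `R ⧸ a` and then lifts to the completion.
      exact (isMatlisReflexive_iff_of_surjective hs).2
        ((isMatlisReflexive_iff_of_surjective (T := R) (S := R ⧸ a)
          Ideal.Quotient.mk_surjective).1 hR)
  · exact ext_of_isMiniMax (P := fun L _ _ => IsFiniteLength R L)
      (fun hfg hA hC => hA.of_exact hfg hC)
      (fun L _ _ hL hLa => isFiniteLength_of_isArtinianRing_quotient hLa (.inl hL))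
      (fun L _ _ hL hLa => isFiniteLength_of_isArtinianRing_quotient hLa (.inr hL))
      (fun L _ _ hL hLa => (isFiniteLength_of_isArtinianRing_quotient hLa (.inr hL)).dual)
      hM hM' le_rfl i
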